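/- **Setting.** Let $Q$ be a finite set. A linear switching system with guards (GLSw-system) $\mathcal H=(\Xi,S,E,G,R)$ consists of: the hybrid state space $\Xi=\bigcup_{i\in Q}\{i\}\times\mathbb R^{n_i}$; for each $i\in Q$ a linear system $S(i):\ \dot x=A_ix+B_iu,\ y=C_ix$ with $u\in\mathbb R^m$, $y\in\mathbb R^l$; a set $E\subseteq Q\times Q$ of transitions; and for each $e=(i,h)\in E$ a guard $G(e)\subseteq\mathbb R^{n_i}$ and a reset matrix $R(e)\in\mathbb R^{n_h\times n_i}$. It is a linear switching system (LSw-system) if $G(e)=\mathbb R^{n_i}$ for all $e=(i,h)\in E$. Fix an initial time $t_0\in\mathbb R$. An execution consists of switching times $t_0<t_1<\dots$ (indexed by $j<L$, $1\le L\le\infty$, with $t_L=\infty$ if $L<\infty$, and finitely many in every bounded interval), a piecewise continuous input $u:\mathbb R\to\mathbb R^m$ (finitely many discontinuities in bounded intervals, one-sided limits everywhere), a hybrid state evolution $\xi(t)=(q(t),x(t))$ and an output $y(t)=C_{q(t)}x(t)$, $t\ge t_0$, such that on each $[t_j,t_{j+1})$ the discrete state $q$ is constant and $x$ solves $S(q(t_j))$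 with input $u$, and for $1\le j<L$, with $e=(q(t_{j-1}),q(t_j))$, one has $e\in E$, $x^-(t_j)=\lim_{t\uparrow t_j}x(t)\in G(e)$ and $x(t_j)=R(e)x^-(t_j)$. Put $\delta((i,x),(h,x'))=\|x-x'\|$ if $i=h$ and $\infty$ otherwise. * $\mathcal H$ is *detectable* if there are an input $\hat u$ and a function $\hat\xi$ with values in $\Xi$ such that for all $\varepsilon,\rho>0$ there is $\hat t>t_0$ with $\delta\big(\hat\xi(y|_{[t_0,t]},\hat u|_{[t_0,t)}),\xi(t)\big)\le\varepsilon$ for every execution with input $\hat u$ and initial continuous state of norm at most $\rho$, and every $t\ge\hat t$ that is not one of the times $t_j$. * $\mathcal H$ is *location observable* if there are an input $\hat u$ and a function $\hat q$ with values in $Q$ such that for all $\rho>0$ there is $\hat t>t_0$ with $\hat q(y|_{[t_0,t]},\hat u|_{[t_0,t)})=q(t)$ for all such executions and all such $t$. * An autonomous GLSw-system (all $B_i=0$) is *asymptotically stable* if for all $\varepsilon,\rho>0$ there is $\hat t>t_0$ such that $\|x(t)\|\le\varepsilon$ for all $t\ge\hat t$ and every execution with initial continuous state of norm at most $\rho$.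 Let $\mathcal O_i$ be the observability matrix of $(A_i,C_i)$, with row blocks $C_iA_i^k$, $0\le k<n_i$, and let $\hat Q=\{i\in Q:\ker\mathcal O_i\ne\{0\}\}$. For each $i\in\hat Q$ choose an invertible $T_i$ that brings $(A_i,C_i)$ into observability canonical form $$T_iA_iT_i^{-1}=\begin{pmatrix}A_i^{(11)}&0\\A_i^{(21)}&A_i^{(22)}\end{pmatrix},\qquad C_iT_i^{-1}=\begin{pmatrix}C_i^{(1)}&0\end{pmatrix},$$ with $(A_i^{(11)},C_i^{(1)})$ observable and $A_i^{(22)}\in\mathbb R^{d_i\times d_i}$. For $e=(i,h)\in E$ with $i,h\in\hat Q$ partition $T_hR(e)T_i^{-1}=\begin{pmatrix}R^{(11)}(e)&R^{(12)}(e)\\R^{(21)}(e)&R^{(22)}(e)\end{pmatrix}$ accordingly. Let $\mathcal H_0$ be the autonomous GLSw-system with discrete states $\hat Q$, continuous state spaces $\mathbb R^{d_i}$, dynamics $\dot z=A_i^{(22)}z$, transitions $E\cap(\hat Q\times\hat Q)$, guards $G_0(e)=\ker R^{(12)}(e)$ and resets $R_0(e)=R^{(22)}(e)$. **Theorem.**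 Let $\mathcal H$ be an LSw-system, and let $\mathcal H_0$ be built from any choice of the transformations $T_i$. Then $\mathcal H$ is detectable if the following three conditions hold: (i) $\mathcal H$ is location observable; (ii) $\operatorname{Im}(R(e)-I)\cap\ker\mathcal O_i=\{0\}$ for every self-loop $e=(i,i)\in E$; (iii) $\mathcal H_0$ is asymptotically stable. Conversely, if $\mathcal H$ is detectable, then (i) and (iii) hold. -/

import Mathlib

open Set Filter Topology MeasureTheory
open scoped ENNReal

noncomputable section

/-- The Euclidean space `ℝⁿ`. -/
abbrev Euc (n : ℕ) : Type := EuclideanSpace ℝ (Fin n)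

/-- Piecewise continuous functions of time: finitely many discontinuities in every bounded
interval, and one-sided limits at every point. -/
def IsPiecewiseContinuous {k : ℕ} (u : ℝ → Euc k) : Prop :=
  (∀ a b : ℝ, {t ∈ Icc a b | ¬ ContinuousAt u t}.Finite) ∧
  ∀ t : ℝ, (∃ v, Tendsto u (𝓝[<] t) (𝓝 v)) ∧ ∃ v, Tendsto u (𝓝[>] t) (𝓝 v)

/-- The observability matrix of the pair `(A, C)`: its row blocks are `C A ^ k`, `k < n`. -/
def obsMatrix {n l : ℕ} (A : Matrix (Fin n) (Fin n) ℝ) (C : Matrix (Fin l) (Fin n) ℝ) :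
    Matrix (Fin n × Fin l) (Fin n) ℝ :=
  Matrix.of fun r c => (C * A ^ (r.1 : ℕ)) r.2 c

/-- The kernel of the observability matrix. -/
def obsKer {n l : ℕ} (A : Matrix (Fin n) (Fin n) ℝ) (C : Matrix (Fin l) (Fin n) ℝ) :
    Submodule ℝ (Euc n) :=
  LinearMap.ker (Matrix.toEuclideanLin (obsMatrix A C))

/-- Observability of the linear system `x' = A x + B u`, `y = C x`. -/
def IsObservablePair {n l : ℕ} (A : Matrix (Fin n) (Fin n) ℝ)
    (C : Matrix (Fin l) (Fin n) ℝ) : Prop :=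
  obsKer A C = ⊥

/-- A linear switching system with guards, with discrete state space `Q`, inputs in `ℝᵐ` and
outputs in `ℝˡ`. The values of `G` and `R` matter only on the set `E` of admissible
transitions. -/
structure GLSw (Q : Type*) (m l : ℕ) where
  /-- dimension of the continuous state space of each discrete state -/
  n : Q → ℕ
  A : ∀ i, Matrix (Fin (n i)) (Fin (n i)) ℝ
  B : ∀ i, Matrix (Fin (n i)) (Fin m) ℝ
  C : ∀ i, Matrix (Fin l) (Fin (n i)) ℝ
  /-- admissible transitions -/
  E : Set (Q × Q)
  /-- guards -/
  G : ∀ i _h : Q, Set (Euc (n i))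
  /-- resets -/
  R : ∀ i h : Q, Matrix (Fin (n h)) (Fin (n i)) ℝ

/-- A hybrid time basis with initial time `t₀`: intervals `[t j, t (j + 1))` for `j < L`,
with `t L = ∞` if `L` is finite, and finitely many switching times in bounded time. -/
structure TimeBasis (t₀ : ℝ) where
  L : ℕ∞
  one_le : 1 ≤ L
  t : ℕ → ℝ
  t_zero : t 0 = t₀
  t_lt : ∀ j : ℕ, ((j + 1 : ℕ) : ℕ∞) < L → t j < t (j + 1)
  nonZeno : ∀ T : ℝ, {j : ℕ | (j : ℕ∞) < L ∧ t j ≤ T}.Finite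

/-- The `j`-th interval `[t j, t (j + 1))`, which is `[t j, ∞)` if `j + 1 = L`. -/
def TimeBasis.interval {t₀ : ℝ} (τ : TimeBasis t₀) (j : ℕ) : Set ℝ :=
  {s | τ.t j ≤ s ∧ (((j + 1 : ℕ) : ℕ∞) < τ.L → s < τ.t (j + 1))}

/-- `s` is one of the times `t j`, `j < L`. -/
def TimeBasis.IsSwitchingTime {t₀ : ℝ} (τ : TimeBasis t₀) (s : ℝ) : Prop :=
  ∃ j : ℕ, (j : ℕ∞) < τ.L ∧ s = τ.t j

namespace GLSw

variable {Q : Type*} {m l : ℕ}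

/-- The hybrid state space. -/
abbrev State (H : GLSw Q m l) : Type _ := Σ i : Q, Euc (H.n i)

/-- The extended metric on the hybrid state space: `∞` between different discrete states,
the Euclidean distance otherwise. -/
def hdist (H : GLSw Q m l) (a b : H.State) : ℝ≥0∞ :=
  open Classical in if h : a.1 = b.1 then edist (h ▸ a.2) b.2 else ⊤

/-- No guards: every admissible transition is enabled everywhere. -/
def IsLSw (H : GLSw Q m l) : Prop :=
  ∀ i h : Q, (i, h) ∈ H.E → H.G i h = univ

/-- `x` solves `x' = A_i x + B_i u` on the time interval `I` with initial time `a`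
(integrated form, as `u` may have discontinuities). -/
def IsSolution (H : GLSw Q m l) (i : Q) (u : ℝ → Euc m) (I : Set ℝ) (a : ℝ)
    (x : ℝ → Euc (H.n i)) : Prop :=
  ContinuousOn x I ∧
  ∀ s ∈ I, x s = x a + ∫ r in a..s,
    (Matrix.toEuclideanLin (H.A i) (x r) + Matrix.toEuclideanLin (H.B i) (u r))

/-- Executions with initial time `t₀`. `mode j` and `x j` are the discrete state and the
continuous state on the `j`-th interval of the time basis. The initial hybrid state is `ξ t₀`;
the values of `ξ` and `y` before time `t₀` play no role. -/
structure Execution (H : GLSw Q m l) (t₀ : ℝ) where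
  τ : TimeBasis t₀
  u : ℝ → Euc m
  u_pc : IsPiecewiseContinuous u
  ξ : ℝ → H.State
  y : ℝ → Euc l
  mode : ℕ → Q
  x : ∀ j, ℝ → Euc (H.n (mode j))
  ξ_eq : ∀ j : ℕ, (j : ℕ∞) < τ.L → ∀ s ∈ τ.interval j, ξ s = ⟨mode j, x j s⟩
  flow : ∀ j : ℕ, (j : ℕ∞) < τ.L → H.IsSolution (mode j) u (τ.interval j) (τ.t j) (x j)
  jump : ∀ j : ℕ, ((j + 1 : ℕ) : ℕ∞) < τ.L →
    (mode j, mode (j + 1)) ∈ H.E ∧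
    ∃ v : Euc (H.n (mode j)), Tendsto (x j) (𝓝[<] τ.t (j + 1)) (𝓝 v) ∧
      v ∈ H.G (mode j) (mode (j + 1)) ∧
      x (j + 1) (τ.t (j + 1)) = Matrix.toEuclideanLin (H.R (mode j) (mode (j + 1))) v
  y_eq : ∀ j : ℕ, (j : ℕ∞) < τ.L → ∀ s ∈ τ.interval j,
    y s = Matrix.toEuclideanLin (H.C (mode j)) (x j s)

/-- Detectability: for some input `û`, the hybrid state at time `t` is asymptotically
reconstructed from the restrictions of `y` to `[t₀, t]` and of `û` to `[t₀, t)`, uniformly over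
the executions with input `û` and initial continuous state in a given ball. -/
def Detectable (H : GLSw Q m l) (t₀ : ℝ) : Prop :=
  ∃ û : ℝ → Euc m, IsPiecewiseContinuous û ∧
  ∃ obs : (t : ℝ) → (Icc t₀ t → Euc l) → (Ico t₀ t → Euc m) → H.State,
    ∀ ε > 0, ∀ ρ > 0, ∃ T > t₀, ∀ χ : H.Execution t₀, χ.u = û → ‖(χ.ξ t₀).2‖ ≤ ρ →
      ∀ t ≥ T, ¬ χ.τ.IsSwitchingTime t →
        H.hdist (obs t ((Icc t₀ t).domRestrict χ.y) ((Ico t₀ t).domRestrict û)) (χ.ξ t)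
          ≤ ENNReal.ofReal ε

/-- Location observability: the same for the exact reconstruction of the discrete state. -/
def LocationObservable (H : GLSw Q m l) (t₀ : ℝ) : Prop :=
  ∃ û : ℝ → Euc m, IsPiecewiseContinuous û ∧
  ∃ obs : (t : ℝ) → (Icc t₀ t → Euc l) → (Ico t₀ t → Euc m) → Q,
    ∀ ρ > 0, ∃ T > t₀, ∀ χ : H.Execution t₀, χ.u = û → ‖(χ.ξ t₀).2‖ ≤ ρ →
      ∀ t ≥ T, ¬ χ.τ.IsSwitchingTime t →
        obs t ((Icc t₀ t).domRestrict χ.y) ((Ico t₀ t).domRestrict û) = (χ.ξ t).1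

/-- Asymptotic stability: the continuous state tends to the origin, uniformly over the
executions with initial continuous state in a given ball. -/
def AsymptoticallyStable (H : GLSw Q m l) (t₀ : ℝ) : Prop :=
  ∀ ε > 0, ∀ ρ > 0, ∃ T > t₀, ∀ χ : H.Execution t₀, ‖(χ.ξ t₀).2‖ ≤ ρ →
    ∀ t ≥ T, ‖(χ.ξ t).2‖ ≤ ε

/-- `Im(R(e) - I) ∩ ker O_i = {0}` for every self-loop `e = (i, i)`. -/
def SelfLoopCondition (H : GLSw Q m l) : Prop :=
  ∀ i : Q, (i, i) ∈ H.E →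
    LinearMap.range (Matrix.toEuclideanLin (H.R i i - 1)) ⊓ obsKer (H.A i) (H.C i) = ⊥

/-- The discrete states whose linear system is not observable. -/
abbrev Unobs (H : GLSw Q m l) : Type _ := {i : Q // ¬ IsObservablePair (H.A i) (H.C i)}

end GLSw

/-- A change of coordinates `x ↦ T x` with inverse `Tinv` that brings the pair `(A, C)` into
observability canonical form: `T A T⁻¹ = [A₁₁, 0; A₂₁, A₂₂]`, `C T⁻¹ = [C₁, 0]` with `(A₁₁, C₁)`
observable and `A₂₂` of size `d`. -/
structure ObsCanonicalForm {n l : ℕ} (A : Matrix (Fin n) (Fin n) ℝ)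
    (C : Matrix (Fin l) (Fin n) ℝ) where
  p : ℕ
  d : ℕ
  T : Matrix (Fin p ⊕ Fin d) (Fin n) ℝ
  Tinv : Matrix (Fin n) (Fin p ⊕ Fin d) ℝ
  T_mul_Tinv : T * Tinv = 1
  Tinv_mul_T : Tinv * T = 1
  A12 : (T * A * Tinv).toBlocks₁₂ = 0
  C2 : (C * Tinv).toCols₂ = 0
  observable : IsObservablePair (T * A * Tinv).toBlocks₁₁ (C * Tinv).toCols₁

namespace GLSw

variable {Q : Type*} {m l : ℕ}

/-- The autonomous system with guards built from the unobservable parts of the canonical forms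
`F`: dynamics `A_i^(22)`, guards `ker R^(12)(e)` and resets `R^(22)(e)`, where `R(e)` is written
in the new coordinates; no inputs and no outputs. -/
def unobservablePart (H : GLSw Q m l)
    (F : ∀ i : H.Unobs, ObsCanonicalForm (H.A i.1) (H.C i.1)) : GLSw H.Unobs 0 0 where
  n i := (F i).d
  A i := ((F i).T * H.A i.1 * (F i).Tinv).toBlocks₂₂
  B _ := 0
  C _ := 0
  E := {e | (e.1.1, e.2.1) ∈ H.E}
  G i h := {z | Matrix.toEuclideanLin ((F h).T * H.R i.1 h.1 * (F i).Tinv).toBlocks₁₂ z = 0}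
  R i h := ((F h).T * H.R i.1 h.1 * (F i).Tinv).toBlocks₂₂

end GLSw

end

/-! Necessity. A finite hybrid distance forces equal discrete states, so detectability gives (i).
For (iii), an execution of the unobservable part is lifted to `H`: run `H` from the origin with the
given input and with the same modes and switching times, and add `c` times the unobservable vector
with coordinates `z`. The guard `ker R^(12)` says exactly that each reset sends this vector to an
unobservable one again, and `H` itself has no guards, so the sum is an execution (`Execution.lift`).
Its output does not depend on `c`. The observer therefore cannot separate `c = 0` from `c = 1`,
which forces `z` to be small.

Sufficiency. If two modes had the same Markov parameters, no input could separate their executions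
from the origin. By (i), the vectors `v` with equal Markov parameters thus form a proper subspace
for each pair of distinct modes, and some `v` avoids these finitely many subspaces. For large `μ`
the transfer functions differ at `μ` in the direction `v`. The input `exp(μt) v` then reveals the
mode on every open interval, whatever the continuous states are: a polynomial annihilating both
state matrices removes the free responses and leaves the transfer difference
(`exists_distinguishing_input`).

With this input, the estimator follows any execution that fits the data and has nearly minimal
initial norm. Compare it with the true execution. Both have the same mode, and the difference of
their states is invisible to the output. If both jump, the difference is reset by `R(e)`, and its
invisibility afterwards is the guard of the unobservable part. If only one jumps, the transition is
a self-loop, and (ii) shows that the jump does not move the state. Hence the difference is zero or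
its unobservable coordinates are reached by an execution of the unobservable part, and (iii) makes
it small, uniformly in the initial states (`Indistinguishable.synchronized_final`). -/

noncomputable section

/-! ### Matrices as continuous linear maps, and invisible states -/

/-- The continuous linear map between Euclidean spaces given by a matrix. -/
def eucCLM {a b : ℕ} (M : Matrix (Fin a) (Fin b) ℝ) : Euc b →L[ℝ] Euc a :=
  LinearMap.toContinuousLinearMap (Matrix.toEuclideanLin M)

theorem toEuclideanLin_eq_eucCLM {a b : ℕ} (M : Matrix (Fin a) (Fin b) ℝ) (x : Euc b) :
    Matrix.toEuclideanLin M x = eucCLM M x := rfl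

theorem eucCLM_mul {a b c : ℕ} (M : Matrix (Fin a) (Fin b) ℝ) (N : Matrix (Fin b) (Fin c) ℝ)
    (x : Euc c) : eucCLM (M * N) x = eucCLM M (eucCLM N x) := by
  simp only [← toEuclideanLin_eq_eucCLM]
  exact congrArg (fun f => f x) (Matrix.toLpLin_mul 2 2 2 M N)

theorem eucCLM_add {a b : ℕ} (M N : Matrix (Fin a) (Fin b) ℝ) (x : Euc b) :
    eucCLM (M + N) x = eucCLM M x + eucCLM N x := by
  simp only [← toEuclideanLin_eq_eucCLM, map_add, LinearMap.add_apply]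

theorem eucCLM_sub {a b : ℕ} (M N : Matrix (Fin a) (Fin b) ℝ) (x : Euc b) :
    eucCLM (M - N) x = eucCLM M x - eucCLM N x := by
  simp only [← toEuclideanLin_eq_eucCLM, map_sub, LinearMap.sub_apply]

theorem eucCLM_one {a : ℕ} (x : Euc a) : eucCLM (1 : Matrix (Fin a) (Fin a) ℝ) x = x := by
  rw [← toEuclideanLin_eq_eucCLM]
  exact congrArg (fun f => f x) (Matrix.toLpLin_one (n := Fin a) (R := ℝ) 2)

theorem eucCLM_zero {a b : ℕ} (x : Euc b) : eucCLM (0 : Matrix (Fin a) (Fin b) ℝ) x = 0 := by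
  simp [← toEuclideanLin_eq_eucCLM]

theorem eucCLM_pow {a : ℕ} (M : Matrix (Fin a) (Fin a) ℝ) (k : ℕ) :
    eucCLM (M ^ k) = eucCLM M ^ k := by
  induction k with
  | zero => ext1 x; simp [eucCLM_one]
  | succ k ih =>
    ext1 x
    rw [pow_succ, eucCLM_mul, ih, pow_succ, mul_apply_eq_comp]

/-- The states that are not seen by the output of the autonomous system `x' = A x`, `y = C x`. -/
def Invisible {n l : ℕ} (A : Matrix (Fin n) (Fin n) ℝ) (C : Matrix (Fin l) (Fin n) ℝ)
    (x : Euc n) : Prop :=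
  ∀ k : ℕ, eucCLM C ((eucCLM A ^ k) x) = 0

theorem mem_obsKer_of_forall_lt {n l : ℕ} {A : Matrix (Fin n) (Fin n) ℝ}
    {C : Matrix (Fin l) (Fin n) ℝ} {x : Euc n}
    (hx : ∀ k < n, eucCLM C ((eucCLM A ^ k) x) = 0) : x ∈ obsKer A C := by
  rw [obsKer, LinearMap.mem_ker]
  ext ⟨k, i⟩
  have h := congrArg (fun v : Euc l => v i) (hx k k.2)
  rw [← eucCLM_pow, ← eucCLM_mul, ← toEuclideanLin_eq_eucCLM, Matrix.toLpLin_apply] at h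
  rw [Matrix.toLpLin_apply]
  exact h

theorem Invisible.mem_obsKer {n l : ℕ} {A : Matrix (Fin n) (Fin n) ℝ}
    {C : Matrix (Fin l) (Fin n) ℝ} {x : Euc n} (hx : Invisible A C x) : x ∈ obsKer A C :=
  mem_obsKer_of_forall_lt fun k _ => hx k

theorem IsObservablePair.eq_zero {n l : ℕ} {A : Matrix (Fin n) (Fin n) ℝ}
    {C : Matrix (Fin l) (Fin n) ℝ} (h : IsObservablePair A C) {x : Euc n}
    (hx : x ∈ obsKer A C) : x = 0 := by
  rw [h] at hx
  simpa using hx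

/-! ### Observability canonical form -/

namespace ObsCanonicalForm

variable {n l : ℕ} {A : Matrix (Fin n) (Fin n) ℝ} {C : Matrix (Fin l) (Fin n) ℝ}
  (F : ObsCanonicalForm A C)

/-- The observable coordinates. -/
def obsProj : Euc n →L[ℝ] Euc F.p := eucCLM F.T.toRows₁

/-- The unobservable coordinates. -/
def unobsProj : Euc n →L[ℝ] Euc F.d := eucCLM F.T.toRows₂

/-- The inclusion of the observable coordinates. -/
def obsIncl : Euc F.p →L[ℝ] Euc n := eucCLM F.Tinv.toCols₁

/-- The inclusion of the unobservable subspace. -/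
def unobsIncl : Euc F.d →L[ℝ] Euc n := eucCLM F.Tinv.toCols₂

/-- The matrix `A₂₂` of the unobservable dynamics. -/
def A22 : Matrix (Fin F.d) (Fin F.d) ℝ := (F.T * A * F.Tinv).toBlocks₂₂

theorem unobsProj_unobsIncl (z : Euc F.d) : F.unobsProj (F.unobsIncl z) = z := by
  rw [unobsProj, unobsIncl, ← eucCLM_mul]
  have : F.T.toRows₂ * F.Tinv.toCols₂ = 1 := by
    have h := congrArg Matrix.toBlocks₂₂ F.T_mul_Tinv
    rw [← Matrix.fromBlocks_one, Matrix.toBlocks_fromBlocks₂₂] at h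
    rw [← h]; rfl
  rw [this, eucCLM_one]

theorem incl_add_incl (x : Euc n) :
    F.obsIncl (F.obsProj x) + F.unobsIncl (F.unobsProj x) = x := by
  simp only [obsProj, unobsProj, obsIncl, unobsIncl, ← eucCLM_mul, ← eucCLM_add]
  rw [← Matrix.fromCols_mul_fromRows, Matrix.fromCols_toCols, Matrix.fromRows_toRows,
    F.Tinv_mul_T, eucCLM_one]

theorem obsProj_apply_unobsIncl (z : Euc F.d) :
    F.obsProj (eucCLM A (F.unobsIncl z)) = 0 := by
  rw [obsProj, unobsIncl, ← eucCLM_mul, ← eucCLM_mul]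
  have : F.T.toRows₁ * A * F.Tinv.toCols₂ = 0 := by rw [← F.A12]; rfl
  rw [this, eucCLM_zero]

theorem unobsProj_apply_unobsIncl (z : Euc F.d) :
    F.unobsProj (eucCLM A (F.unobsIncl z)) = eucCLM F.A22 z := by
  rw [unobsProj, unobsIncl, ← eucCLM_mul, ← eucCLM_mul]
  rfl

theorem apply_unobsIncl (z : Euc F.d) :
    eucCLM A (F.unobsIncl z) = F.unobsIncl (eucCLM F.A22 z) := by
  rw [← F.incl_add_incl (eucCLM A (F.unobsIncl z)), F.obsProj_apply_unobsIncl,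
    F.unobsProj_apply_unobsIncl, map_zero, zero_add]

theorem output_unobsIncl (z : Euc F.d) : eucCLM C (F.unobsIncl z) = 0 := by
  rw [unobsIncl, ← eucCLM_mul]
  have : C * F.Tinv.toCols₂ = 0 := by rw [← F.C2]; rfl
  rw [this, eucCLM_zero]

theorem output_eq (x : Euc n) :
    eucCLM C x = eucCLM (C * F.Tinv).toCols₁ (F.obsProj x) := by
  have h : (C * F.Tinv).toCols₁ = C * F.Tinv.toCols₁ := rfl
  conv_lhs => rw [← F.incl_add_incl x, map_add, F.output_unobsIncl, add_zero]
  rw [h, eucCLM_mul]; rfl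

theorem obsProj_apply (x : Euc n) :
    F.obsProj (eucCLM A x) = eucCLM (F.T * A * F.Tinv).toBlocks₁₁ (F.obsProj x) := by
  have h : (F.T * A * F.Tinv).toBlocks₁₁ = F.T.toRows₁ * A * F.Tinv.toCols₁ := rfl
  conv_lhs => rw [← F.incl_add_incl x, map_add, map_add, F.obsProj_apply_unobsIncl, add_zero]
  rw [h, eucCLM_mul, eucCLM_mul]; rfl

theorem output_pow (k : ℕ) (x : Euc n) : eucCLM C ((eucCLM A ^ k) x) =
    eucCLM (C * F.Tinv).toCols₁ ((eucCLM (F.T * A * F.Tinv).toBlocks₁₁ ^ k) (F.obsProj x)) := by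
  rw [F.output_eq]
  congr 1
  induction k with
  | zero => simp
  | succ k ih => rw [pow_succ', mul_apply_eq_comp, F.obsProj_apply, ih, pow_succ',
      mul_apply_eq_comp]

/-- The output and its derivatives factor through the pair `(A₁₁, C₁)`, which is observable. Since
invisibility covers all powers of `A`, Cayley–Hamilton is not needed. -/
theorem obsProj_eq_zero {x : Euc n} (hx : Invisible A C x) : F.obsProj x = 0 := by
  refine F.observable.eq_zero (mem_obsKer_of_forall_lt fun k _ => ?_)
  rw [← F.output_pow]
  exact hx k

theorem unobsIncl_unobsProj {x : Euc n} (hx : Invisible A C x) :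
    F.unobsIncl (F.unobsProj x) = x := by
  conv_rhs => rw [← F.incl_add_incl x, F.obsProj_eq_zero hx, map_zero, zero_add]

theorem unobsProj_apply {x : Euc n} (hx : Invisible A C x) :
    F.unobsProj (eucCLM A x) = eucCLM F.A22 (F.unobsProj x) := by
  conv_lhs => rw [← F.unobsIncl_unobsProj hx]
  rw [F.unobsProj_apply_unobsIncl]

variable {n' l' : ℕ} {A' : Matrix (Fin n') (Fin n') ℝ} {C' : Matrix (Fin l') (Fin n') ℝ}
  (F' : ObsCanonicalForm A' C') (R : Matrix (Fin n') (Fin n) ℝ)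

theorem toBlocks₁₂_reset (z : Euc F.d) :
    eucCLM (F'.T * R * F.Tinv).toBlocks₁₂ z = F'.obsProj (eucCLM R (F.unobsIncl z)) := by
  rw [obsProj, unobsIncl, ← eucCLM_mul, ← eucCLM_mul]
  rfl

theorem toBlocks₂₂_reset (z : Euc F.d) :
    eucCLM (F'.T * R * F.Tinv).toBlocks₂₂ z = F'.unobsProj (eucCLM R (F.unobsIncl z)) := by
  rw [unobsProj, unobsIncl, ← eucCLM_mul, ← eucCLM_mul]
  rfl

/-- The hypothesis is the guard of the unobservable part. It kills the observable component of the
reset vector, so only the `R^(22)` component survives. -/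
theorem reset_unobsIncl {z : Euc F.d} (hz : eucCLM (F'.T * R * F.Tinv).toBlocks₁₂ z = 0) :
    eucCLM R (F.unobsIncl z) = F'.unobsIncl (eucCLM (F'.T * R * F.Tinv).toBlocks₂₂ z) := by
  rw [toBlocks₁₂_reset] at hz
  rw [toBlocks₂₂_reset, ← F'.incl_add_incl (eucCLM R (F.unobsIncl z)), hz, map_zero, zero_add,
    F'.unobsProj_unobsIncl]

end ObsCanonicalForm

/-! ### Integrability of piecewise continuous inputs -/

theorem IsPiecewiseContinuous.countable {k : ℕ} {u : ℝ → Euc k} (hu : IsPiecewiseContinuous u) :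
    {t | ¬ ContinuousAt u t}.Countable := by
  have : {t | ¬ ContinuousAt u t} = ⋃ n : ℕ, {t ∈ Icc (-n : ℝ) n | ¬ ContinuousAt u t} := by
    ext t
    simp only [mem_iUnion, Set.mem_ofPred_eq, mem_Icc]
    refine ⟨fun h => ?_, fun ⟨n, hn⟩ => hn.2⟩
    obtain ⟨n, hn⟩ := exists_nat_ge |t|
    exact ⟨n, abs_le.1 hn, h⟩
  rw [this]
  exact countable_iUnion fun n => (hu.1 _ _).countable

theorem aestronglyMeasurable_of_countable {E : Type*} [NormedAddCommGroup E]
    [SecondCountableTopology E] {u : ℝ → E} (hu : {t | ¬ ContinuousAt u t}.Countable) :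
    AEStronglyMeasurable u volume := by
  have hm : MeasurableSet {t | ¬ ContinuousAt u t}ᶜ := hu.measurableSet.compl
  have h1 : ContinuousOn u {t | ¬ ContinuousAt u t}ᶜ := fun t ht =>
    (not_not.1 ht).continuousWithinAt
  have h2 := h1.aestronglyMeasurable (μ := volume) hm
  rwa [Measure.restrict_eq_self_of_ae_mem] at h2
  exact hu.ae_notMem _

/-- One-sided limits give integrability near `t` on the left and on the right. Together with the
point `t` these fill a neighbourhood, and compactness does the rest. -/
theorem IsPiecewiseContinuous.intervalIntegrable {k : ℕ} {u : ℝ → Euc k}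
    (hu : IsPiecewiseContinuous u) (a b : ℝ) : IntervalIntegrable u volume a b := by
  have hm := aestronglyMeasurable_of_countable hu.countable
  have hloc : LocallyIntegrable u volume := by
    intro t
    obtain ⟨⟨v, hv⟩, w, hw⟩ := hu.2 t
    have key : ∀ (s : Set ℝ) (v : Euc k), MeasurableSet s → Tendsto u (𝓝[s] t) (𝓝 v) →
        IntegrableAtFilter u (𝓝[s] t) volume := fun s v hs hv =>
      have := hs.nhdsWithin_isMeasurablyGenerated t
      hv.integrableAtFilter (hm.stronglyMeasurableAtFilter) (volume.finiteAt_nhdsWithin t s)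
    have h1 := key _ v measurableSet_Iio hv
    have h2 := key _ w measurableSet_Ioi hw
    have h3 := key {t} (u t) (measurableSet_singleton t) (by
      rw [nhdsWithin_singleton]; exact tendsto_pure_nhds u t)
    have h4 := IntegrableAtFilter.sup_iff.2 ⟨IntegrableAtFilter.sup_iff.2 ⟨h1, h3⟩, h2⟩
    have h5 : 𝓝[<] t ⊔ 𝓝[{t}] t ⊔ 𝓝[>] t = 𝓝 t := by
      rw [← nhdsWithin_union, ← nhdsWithin_union, ← nhdsWithin_univ]
      congr 1
      ext x
      simp
    rwa [h5] at h4
  exact ⟨(hloc.integrableOn_isCompact isCompact_Icc).mono_set Ioc_subset_Icc_self,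
    (hloc.integrableOn_isCompact isCompact_Icc).mono_set Ioc_subset_Icc_self⟩

/-! ### Linear flows and variation of constants -/

section Flow

variable {E : Type*} [NormedAddCommGroup E] [NormedSpace ℝ E] [CompleteSpace E]

/-- The flow of `x' = A x`. -/
def linFlow (A : E →L[ℝ] E) (s : ℝ) : E →L[ℝ] E := NormedSpace.exp (s • A)

omit [CompleteSpace E] in
@[simp] theorem linFlow_zero (A : E →L[ℝ] E) : linFlow A 0 = 1 := by simp [linFlow]

theorem hasDerivAt_linFlow (A : E →L[ℝ] E) (s : ℝ) :
    HasDerivAt (linFlow A) (linFlow A s * A) s := hasDerivAt_exp_smul_const A s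

theorem hasDerivAt_linFlow' (A : E →L[ℝ] E) (s : ℝ) :
    HasDerivAt (linFlow A) (A * linFlow A s) s := hasDerivAt_exp_smul_const' A s

theorem continuous_linFlow (A : E →L[ℝ] E) : Continuous (linFlow A) :=
  continuous_iff_continuousAt.2 fun s => (hasDerivAt_linFlow A s).continuousAt

theorem linFlow_add (A : E →L[ℝ] E) (s t : ℝ) :
    linFlow A (s + t) = linFlow A s * linFlow A t := by
  let _ : NormedAlgebra ℚ (E →L[ℝ] E) := NormedAlgebra.restrictScalars ℚ ℝ _
  rw [linFlow, add_smul, NormedSpace.exp_add_of_commute]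
  · rfl
  · exact ((Commute.refl A).smul_left s).smul_right t

theorem linFlow_mul_neg (A : E →L[ℝ] E) (s : ℝ) : linFlow A s * linFlow A (-s) = 1 := by
  rw [← linFlow_add, add_neg_cancel, linFlow_zero]

/-- Uniqueness for `x' = A x`. -/
theorem eq_linFlow (A : E →L[ℝ] E) {x : ℝ → E} {a b : ℝ} (hab : a ≤ b)
    (hc : ContinuousOn x (Icc a b)) (hd : ∀ r ∈ Ioo a b, HasDerivAt x (A (x r)) r) :
    x b = linFlow A (b - a) (x a) := by
  -- Transporting `x r` along the flow to time `b` gives a curve with zero derivative, whose values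
  -- at `a` and `b` are the two sides.
  have h1 : ContinuousOn (fun r => linFlow A (b - r) (x r)) (Icc a b) :=
    ContinuousOn.clm_apply ((continuous_linFlow A).comp (by fun_prop)).continuousOn hc
  have h2 : ∀ r ∈ Ioo a b, HasDerivAt (fun r => linFlow A (b - r) (x r)) 0 r := by
    intro r hr
    have h3 : HasDerivAt (fun r => linFlow A (b - r)) (-(linFlow A (b - r) * A)) r := by
      have := (hasDerivAt_linFlow A (b - r)).scomp r ((hasDerivAt_id r).const_sub b)
      rwa [neg_one_smul] at this
    have h4 := h3.clm_apply (hd r hr)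
    have h5 : (-(linFlow A (b - r) * A)) (x r) + (linFlow A (b - r)) (A (x r)) = 0 := by
      simp
    rwa [h5] at h4
  have := intervalIntegral.integral_eq_sub_of_hasDerivAt_of_le hab h1 h2
    (intervalIntegrable_const)
  simp only [intervalIntegral.integral_zero, sub_self, linFlow_zero] at this
  exact (sub_eq_zero.1 this.symm)

/-- Variation of constants. -/
def linSol (A : E →L[ℝ] E) (g : ℝ → E) (a : ℝ) (x₀ : E) (s : ℝ) : E :=
  linFlow A (s - a) (x₀ + ∫ r in a..s, linFlow A (a - r) (g r))

omit [CompleteSpace E] in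
@[simp] theorem linSol_self (A : E →L[ℝ] E) (g : ℝ → E) (a : ℝ) (x₀ : E) :
    linSol A g a x₀ a = x₀ := by simp [linSol]

/-- The integrability and measurability of a forcing term under which the variation of
constants formula solves `x' = A x + g`. -/
structure IsForcing (g : ℝ → E) : Prop where
  countable : {t | ¬ ContinuousAt g t}.Countable
  aestronglyMeasurable : AEStronglyMeasurable g volume
  intervalIntegrable : ∀ a b, IntervalIntegrable g volume a b

namespace IsForcing

variable {g : ℝ → E} (hg : IsForcing g) (A : E →L[ℝ] E)

include hg in
theorem intervalIntegrable_linFlow (c a b : ℝ) :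
    IntervalIntegrable (fun r => linFlow A (c - r) (g r)) volume a b := by
  have hL : Continuous fun r => linFlow A (c - r) := (continuous_linFlow A).comp (by fun_prop)
  obtain ⟨M, hM⟩ := isCompact_uIcc.exists_bound_of_continuousOn (hL.continuousOn (s := uIcc a b))
  rw [intervalIntegrable_iff]
  refine (ContinuousLinearMap.id ℝ (E →L[ℝ] E)).integrable_of_bilin_of_bdd_left M
    hL.aestronglyMeasurable ?_ ((intervalIntegrable_iff.1 (hg.intervalIntegrable a b)))
  exact (ae_restrict_mem measurableSet_uIoc).mono fun r hr => hM r (uIoc_subset_uIcc hr)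

include hg in
theorem continuous_linSol (a : ℝ) (x₀ : E) : Continuous (linSol A g a x₀) := by
  have h := intervalIntegral.continuous_primitive (hg.intervalIntegrable_linFlow A a) a
  exact ((continuous_linFlow A).comp (by fun_prop : Continuous fun s : ℝ => s - a)).clm_apply
    (continuous_const.add h)

include hg in
theorem hasDerivAt_linSol (a : ℝ) (x₀ : E) {s : ℝ} (hs : ContinuousAt g s) :
    HasDerivAt (linSol A g a x₀) (A (linSol A g a x₀ s) + g s) s := by
  have hL : Continuous fun r => linFlow A (a - r) := (continuous_linFlow A).comp (by fun_prop)
  have hm : AEStronglyMeasurable (fun r => linFlow A (a - r) (g r)) volume :=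
    (ContinuousLinearMap.id ℝ (E →L[ℝ] E)).aestronglyMeasurable_comp₂
      hL.aestronglyMeasurable hg.aestronglyMeasurable
  have h1 := intervalIntegral.integral_hasDerivAt_right (hg.intervalIntegrable_linFlow A a a s)
    hm.stronglyMeasurableAtFilter (hL.continuousAt.clm_apply hs)
  have h2 : HasDerivAt (fun s => linFlow A (s - a)) (A * linFlow A (s - a)) s := by
    have := (hasDerivAt_linFlow' A (s - a)).scomp s ((hasDerivAt_id s).sub_const a)
    rwa [one_smul] at this
  have h3 := h2.clm_apply (h1.const_add x₀)
  have h4 : linFlow A (s - a) (linFlow A (a - s) (g s)) = g s := by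
    rw [← mul_apply_eq_comp, ← neg_sub s a, linFlow_mul_neg, one_apply_eq_self]
  rw [h4] at h3
  exact h3

include hg in
theorem linSol_eq (a : ℝ) (x₀ : E) (s : ℝ) :
    linSol A g a x₀ s = linSol A g a x₀ a + ∫ r in a..s, (A (linSol A g a x₀ r) + g r) := by
  have hc := hg.continuous_linSol A a x₀
  -- The equation may fail only at the countably many discontinuities of the forcing, which this
  -- form of the fundamental theorem tolerates.
  rw [integral_eq_of_hasDerivAt_off_countable (linSol A g a x₀) _ hg.countable hc.continuousOn
    (fun r hr => hg.hasDerivAt_linSol A a x₀ (not_not.1 hr.2))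
    (((A.continuous.comp hc).intervalIntegrable a s).add (hg.intervalIntegrable a s))]
  abel

include hg in
theorem linSol_zero_left (a s : ℝ) :
    linSol A g a 0 s = ∫ r in a..s, linFlow A (s - r) (g r) := by
  rw [linSol, zero_add, ← ContinuousLinearMap.intervalIntegral_comp_comm _
    (hg.intervalIntegrable_linFlow A a a s)]
  refine intervalIntegral.integral_congr fun r _ => ?_
  simp only [← mul_apply_eq_comp, ← linFlow_add, sub_add_sub_cancel]

end IsForcing

omit [CompleteSpace E] in
theorem IsPiecewiseContinuous.isForcing {k : ℕ} {u : ℝ → Euc k} (hu : IsPiecewiseContinuous u)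
    (B : Euc k →L[ℝ] E) : IsForcing fun r => B (u r) where
  countable := hu.countable.mono fun _ ht h => ht (B.continuous.continuousAt.comp h)
  aestronglyMeasurable := B.continuous.comp_aestronglyMeasurable
    (aestronglyMeasurable_of_countable hu.countable)
  intervalIntegrable a b := ⟨B.integrable_comp (hu.intervalIntegrable a b).1,
    B.integrable_comp (hu.intervalIntegrable a b).2⟩

/-- Solutions of the integrated equation with continuous forcing are differentiable. -/
theorem hasDerivAt_of_integral_eq {A : E →L[ℝ] E} {g : ℝ → E} (hg : Continuous g) {x : ℝ → E}
    {a b : ℝ} (hc : ContinuousOn x (Ico a b))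
    (hx : ∀ s ∈ Ico a b, x s = x a + ∫ r in a..s, (A (x r) + g r)) {s : ℝ} (hs : s ∈ Ioo a b) :
    HasDerivAt x (A (x s) + g s) s := by
  have hc' : ContinuousOn (fun r => A (x r) + g r) (Ico a b) :=
    (A.continuous.comp_continuousOn hc).add hg.continuousOn
  have h1 : IntervalIntegrable (fun r => A (x r) + g r) volume a s := by
    refine (hc'.mono ?_).intervalIntegrable
    rw [uIcc_of_le hs.1.le]
    exact fun r hr => ⟨hr.1, hr.2.trans_lt hs.2⟩
  have h2 := intervalIntegral.integral_hasDerivAt_right h1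
    ((hc'.mono Ioo_subset_Ico_self).stronglyMeasurableAtFilter isOpen_Ioo s hs)
    (hc'.continuousAt (Ico_mem_nhds hs.1 hs.2))
  refine (h2.const_add (x a)).congr_of_eventuallyEq ?_
  filter_upwards [Ico_mem_nhds hs.1 hs.2] with r hr using hx r hr

end Flow

/-! ### Hybrid time -/

namespace TimeBasis

variable {t₀ : ℝ} (τ : TimeBasis t₀)

theorem lt_of_succ_lt {L : ℕ∞} {j : ℕ} (h : ((j + 1 : ℕ) : ℕ∞) < L) : (j : ℕ∞) < L :=
  lt_of_le_of_lt (by exact_mod_cast Nat.le_succ j) h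

theorem zero_lt_L : ((0 : ℕ) : ℕ∞) < τ.L := lt_of_lt_of_le (by simp) τ.one_le

theorem t_lt_t {j k : ℕ} (hjk : j < k) (hk : (k : ℕ∞) < τ.L) : τ.t j < τ.t k := by
  induction k, hjk using Nat.le_induction with
  | base => exact τ.t_lt j hk
  | succ k _ ih => exact (ih (lt_of_succ_lt hk)).trans (τ.t_lt k hk)

theorem t_le_t {j k : ℕ} (hjk : j ≤ k) (hk : (k : ℕ∞) < τ.L) : τ.t j ≤ τ.t k := by
  rcases hjk.eq_or_lt with rfl | h
  · rfl
  · exact (τ.t_lt_t h hk).le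

theorem le_t {j : ℕ} (hj : (j : ℕ∞) < τ.L) : t₀ ≤ τ.t j := by
  have := τ.t_le_t (Nat.zero_le j) hj
  rwa [τ.t_zero] at this

theorem exists_mem_interval {s : ℝ} (hs : t₀ ≤ s) :
    ∃ j : ℕ, (j : ℕ∞) < τ.L ∧ s ∈ τ.interval j := by
  obtain ⟨j, hj, hmax⟩ := (τ.nonZeno s).exists_maximal
    ⟨0, τ.zero_lt_L, by rw [τ.t_zero]; exact hs⟩
  refine ⟨j, hj.1, hj.2, fun h => ?_⟩
  by_contra! hle
  exact absurd (hmax ⟨h, hle⟩ (Nat.le_succ j)) (by simp)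

theorem le_of_mem_interval {s : ℝ} {j k : ℕ} (hk : (k : ℕ∞) < τ.L)
    (hjs : s ∈ τ.interval j) (hks : τ.t k ≤ s) : k ≤ j := by
  by_contra! h
  have hj1 : ((j + 1 : ℕ) : ℕ∞) < τ.L := lt_of_le_of_lt (by exact_mod_cast h) hk
  exact absurd (hjs.2 hj1) (not_lt.2 ((τ.t_le_t h hk).trans hks))

theorem eq_of_mem_interval {s : ℝ} {j k : ℕ} (hj : (j : ℕ∞) < τ.L) (hk : (k : ℕ∞) < τ.L)
    (hjs : s ∈ τ.interval j) (hks : s ∈ τ.interval k) : j = k :=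
  le_antisymm (τ.le_of_mem_interval hj hks hjs.1) (τ.le_of_mem_interval hk hjs hks.1)

theorem left_mem_interval {j : ℕ} : τ.t j ∈ τ.interval j :=
  ⟨le_rfl, fun h => τ.t_lt j h⟩

theorem t_zero_mem_interval : t₀ ∈ τ.interval 0 := by
  have := τ.left_mem_interval (j := 0)
  rwa [τ.t_zero] at this

theorem Icc_subset_interval {j : ℕ} {s : ℝ} (hs : s ∈ τ.interval j) :
    Icc (τ.t j) s ⊆ τ.interval j := fun _ hr => ⟨hr.1, fun h => hr.2.trans_lt (hs.2 h)⟩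

theorem exists_mem_interval_gt {j : ℕ} {s : ℝ} (hs : s ∈ τ.interval j) :
    ∃ b > s, b ∈ τ.interval j := by
  by_cases h : ((j + 1 : ℕ) : ℕ∞) < τ.L
  · obtain ⟨b, hb, hb'⟩ := exists_between (hs.2 h)
    exact ⟨b, hb, hs.1.trans hb.le, fun _ => hb'⟩
  · exact ⟨s + 1, by linarith, by linarith [hs.1], fun h' => absurd h' h⟩

theorem Ico_subset_interval {j : ℕ} : Ico (τ.t j) (τ.t (j + 1)) ⊆ τ.interval j :=
  fun _ hs => ⟨hs.1, fun _ => hs.2⟩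

theorem not_isSwitchingTime {j : ℕ} {s : ℝ} (hj : (j : ℕ∞) < τ.L)
    (hs : s ∈ τ.interval j) (h : τ.t j < s) : ¬ τ.IsSwitchingTime s := by
  rintro ⟨k, hk, rfl⟩
  exact absurd h (not_lt.2 (τ.t_le_t (τ.le_of_mem_interval hk hs le_rfl) hj))

end TimeBasis

/-! ### Assembling executions from pieces, and arcs of executions -/

namespace GLSw

variable {Q : Type*} {m l : ℕ} {H : GLSw Q m l} {t₀ : ℝ}

/-- A discrete state together with a curve in its continuous state space. -/
abbrev Piece (H : GLSw Q m l) : Type _ := Σ i : Q, ℝ → Euc (H.n i)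

/-- The condition on two consecutive pieces of an execution that switches at time `s`. -/
def Jump (H : GLSw Q m l) (s : ℝ) (p q : H.Piece) : Prop :=
  (p.1, q.1) ∈ H.E ∧ ∃ v : Euc (H.n p.1), Tendsto p.2 (𝓝[<] s) (𝓝 v) ∧
    v ∈ H.G p.1 q.1 ∧ q.2 s = Matrix.toEuclideanLin (H.R p.1 q.1) v

open Classical in
/-- The piece that is active at time `s`. -/
def activePiece (τ : TimeBasis t₀) (p : ℕ → H.Piece) (s : ℝ) : H.Piece :=
  if h : ∃ j : ℕ, (j : ℕ∞) < τ.L ∧ s ∈ τ.interval j then p h.choose else p 0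

theorem activePiece_eq (τ : TimeBasis t₀) (p : ℕ → H.Piece) {j : ℕ} (hj : (j : ℕ∞) < τ.L)
    {s : ℝ} (hs : s ∈ τ.interval j) : activePiece τ p s = p j := by
  have h : ∃ j : ℕ, (j : ℕ∞) < τ.L ∧ s ∈ τ.interval j := ⟨j, hj, hs⟩
  rw [activePiece, dif_pos h,
    τ.eq_of_mem_interval h.choose_spec.1 hj h.choose_spec.2 hs]

/-- The execution that consists of given pieces. -/
def Execution.ofPieces (τ : TimeBasis t₀) (u : ℝ → Euc m) (hu : IsPiecewiseContinuous u)
    (p : ℕ → H.Piece)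
    (flow : ∀ j : ℕ, (j : ℕ∞) < τ.L → H.IsSolution (p j).1 u (τ.interval j) (τ.t j) (p j).2)
    (jump : ∀ j : ℕ, ((j + 1 : ℕ) : ℕ∞) < τ.L → H.Jump (τ.t (j + 1)) (p j) (p (j + 1))) :
    H.Execution t₀ where
  τ := τ
  u := u
  u_pc := hu
  ξ s := ⟨(activePiece τ p s).1, (activePiece τ p s).2 s⟩
  y s := Matrix.toEuclideanLin (H.C (activePiece τ p s).1) ((activePiece τ p s).2 s)
  mode j := (p j).1
  x j := (p j).2
  ξ_eq j hj s hs := by rw [activePiece_eq τ p hj hs]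
  flow := flow
  jump := jump
  y_eq j hj s hs := by rw [activePiece_eq τ p hj hs]

namespace Execution

variable (χ : H.Execution t₀)

/-- On `[a, b)` the execution `χ` stays in the discrete state `i` and follows the curve `x`. -/
structure Arc (i : Q) (x : ℝ → Euc (H.n i)) (a b : ℝ) : Prop where
  lt : a < b
  ξ_eq : ∀ r ∈ Ico a b, χ.ξ r = ⟨i, x r⟩
  y_eq : ∀ r ∈ Ico a b, χ.y r = eucCLM (H.C i) (x r)
  continuousOn : ContinuousOn x (Icc a b)
  hasDerivAt : ∀ r ∈ Ioo a b,
    HasDerivAt x (eucCLM (H.A i) (x r) + eucCLM (H.B i) (χ.u r)) r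

variable {χ}

theorem Arc.mono {i : Q} {x : ℝ → Euc (H.n i)} {a b a' b' : ℝ} (h : χ.Arc i x a b)
    (ha : a ≤ a') (hb : b' ≤ b) (hab : a' < b') : χ.Arc i x a' b' where
  lt := hab
  ξ_eq r hr := h.ξ_eq r ⟨ha.trans hr.1, hr.2.trans_le hb⟩
  y_eq r hr := h.y_eq r ⟨ha.trans hr.1, hr.2.trans_le hb⟩
  continuousOn := h.continuousOn.mono (Icc_subset_Icc ha hb)
  hasDerivAt r hr := h.hasDerivAt r ⟨ha.trans_lt hr.1, hr.2.trans_le hb⟩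

theorem arc_of_interval (hu : Continuous χ.u) {j : ℕ} (hj : (j : ℕ∞) < χ.τ.L) {a b : ℝ}
    (ha : χ.τ.t j ≤ a) (hab : a < b) (hb : Ico (χ.τ.t j) b ⊆ χ.τ.interval j)
    {x : ℝ → Euc (H.n (χ.mode j))} (hx : EqOn x (χ.x j) (Ico a b))
    (hc : ContinuousOn x (Icc a b)) : χ.Arc (χ.mode j) x a b where
  lt := hab
  ξ_eq r hr := by rw [hx hr]; exact χ.ξ_eq j hj r (hb ⟨ha.trans hr.1, hr.2⟩)
  y_eq r hr := by rw [hx hr]; exact χ.y_eq j hj r (hb ⟨ha.trans hr.1, hr.2⟩)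
  continuousOn := hc
  hasDerivAt r hr := by
    have h1 := hasDerivAt_of_integral_eq (A := eucCLM (H.A (χ.mode j)))
      ((eucCLM (H.B (χ.mode j))).continuous.comp hu) ((χ.flow j hj).1.mono hb)
      (fun s hs => (χ.flow j hj).2 s (hb hs)) ⟨ha.trans_lt hr.1, hr.2⟩
    rw [hx (Ioo_subset_Ico_self hr)]
    refine h1.congr_of_eventuallyEq ?_
    filter_upwards [Ioo_mem_nhds hr.1 hr.2] with s hs using hx (Ioo_subset_Ico_self hs)

variable (χ) in
theorem exists_arc_right (hu : Continuous χ.u) {s : ℝ} (hs : t₀ ≤ s) :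
    ∃ i x b, χ.Arc i x s b := by
  obtain ⟨j, hj, hsj⟩ := χ.τ.exists_mem_interval hs
  obtain ⟨b, hb, hbj⟩ := χ.τ.exists_mem_interval_gt hsj
  exact ⟨_, χ.x j, b, arc_of_interval hu hj hsj.1 hb
    (Ico_subset_Icc_self.trans (χ.τ.Icc_subset_interval hbj)) (fun _ _ => rfl)
    ((χ.flow j hj).1.mono ((Icc_subset_Icc_left hsj.1).trans (χ.τ.Icc_subset_interval hbj)))⟩

variable (χ) in
theorem exists_arc_left (hu : Continuous χ.u) {s : ℝ} (hs : t₀ < s) :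
    ∃ i x a, t₀ ≤ a ∧ χ.Arc i x a s ∧ (χ.ξ s = ⟨i, x s⟩ ∨
      χ.τ.IsSwitchingTime s ∧ ∃ h, (i, h) ∈ H.E ∧ χ.ξ s = ⟨h, eucCLM (H.R i h) (x s)⟩) := by
  obtain ⟨j, hj, hsj⟩ := χ.τ.exists_mem_interval hs.le
  rcases hsj.1.eq_or_lt with heq | hlt
  · obtain _ | k := j
    · rw [χ.τ.t_zero] at heq
      exact absurd heq hs.ne
    · subst heq
      have hk := TimeBasis.lt_of_succ_lt hj
      obtain ⟨hE, v, hv, -, hR⟩ := χ.jump k hj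
      have hlt := χ.τ.t_lt k hj
      -- At a switching time the arc on the left is the preceding piece, closed up by its left
      -- limit.
      refine ⟨χ.mode k, Function.update (χ.x k) (χ.τ.t (k + 1)) v, χ.τ.t k, χ.τ.le_t hk,
        arc_of_interval hu hk le_rfl hlt χ.τ.Ico_subset_interval
        (fun r hr => Function.update_of_ne hr.2.ne _ _) ?_, .inr ⟨⟨k + 1, hj, rfl⟩, χ.mode (k + 1),
          hE, ?_⟩⟩
      · rw [continuousOn_update_iff]
        have : Icc (χ.τ.t k) (χ.τ.t (k + 1)) \ {χ.τ.t (k + 1)} =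
            Ico (χ.τ.t k) (χ.τ.t (k + 1)) := by simp
        rw [this]
        exact ⟨(χ.flow k hk).1.mono χ.τ.Ico_subset_interval, fun _ =>
          hv.mono_left (nhdsWithin_mono _ fun r hr => hr.2)⟩
      · rw [Function.update_self, χ.ξ_eq _ hj _ χ.τ.left_mem_interval, hR]
        rfl
  · exact ⟨χ.mode j, χ.x j, χ.τ.t j, χ.τ.le_t hj, arc_of_interval hu hj le_rfl hlt
      (Ico_subset_Icc_self.trans (χ.τ.Icc_subset_interval hsj)) (fun _ _ => rfl)
      ((χ.flow j hj).1.mono (χ.τ.Icc_subset_interval hsj)), .inl (χ.ξ_eq j hj s hsj)⟩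

end Execution

/-- The solution of the linear system of the discrete state `i`. -/
def sol (H : GLSw Q m l) (i : Q) (u : ℝ → Euc m) (a : ℝ) (x₀ : Euc (H.n i)) : ℝ → Euc (H.n i) :=
  linSol (eucCLM (H.A i)) (fun r => eucCLM (H.B i) (u r)) a x₀

@[simp] theorem sol_self (i : Q) (u : ℝ → Euc m) (a : ℝ) (x₀ : Euc (H.n i)) :
    H.sol i u a x₀ a = x₀ := linSol_self _ _ _ _

theorem continuous_sol (i : Q) {u : ℝ → Euc m} (hu : IsPiecewiseContinuous u) (a : ℝ)
    (x₀ : Euc (H.n i)) : Continuous (H.sol i u a x₀) :=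
  (hu.isForcing _).continuous_linSol _ _ _

theorem isSolution_sol (i : Q) {u : ℝ → Euc m} (hu : IsPiecewiseContinuous u) (a : ℝ)
    (x₀ : Euc (H.n i)) (I : Set ℝ) : H.IsSolution i u I a (H.sol i u a x₀) :=
  ⟨(continuous_sol i hu a x₀).continuousOn, fun s _ => (hu.isForcing _).linSol_eq _ a x₀ s⟩

/-- The time basis without switching. -/
def _root_.TimeBasis.single (t₀ : ℝ) : TimeBasis t₀ where
  L := 1
  one_le := le_rfl
  t _ := t₀
  t_zero := rfl
  t_lt j hj := absurd hj (by simp)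
  nonZeno T := (finite_singleton 0).subset fun j hj => by simpa using hj.1

/-- The execution without switching. -/
def Execution.single (H : GLSw Q m l) (t₀ : ℝ) (i : Q) {u : ℝ → Euc m}
    (hu : IsPiecewiseContinuous u) (x₀ : Euc (H.n i)) : H.Execution t₀ :=
  Execution.ofPieces (TimeBasis.single t₀) u hu (fun _ => ⟨i, H.sol i u t₀ x₀⟩)
    (fun _ _ => isSolution_sol i hu t₀ x₀ _) fun j hj => absurd hj (by simp [TimeBasis.single])

end GLSw

theorem Continuous.isPiecewiseContinuous {k : ℕ} {u : ℝ → Euc k} (hu : Continuous u) :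
    IsPiecewiseContinuous u :=
  ⟨fun a b => by simp [hu.continuousAt], fun t =>
    ⟨⟨u t, (hu.tendsto t).mono_left nhdsWithin_le_nhds⟩,
      u t, (hu.tendsto t).mono_left nhdsWithin_le_nhds⟩⟩

/-! ### Markov parameters and transfer functions -/

section Outputs

variable {E₁ E₂ F : Type*} [NormedAddCommGroup E₁] [NormedSpace ℝ E₁] [CompleteSpace E₁]
  [NormedAddCommGroup E₂] [NormedSpace ℝ E₂] [CompleteSpace E₂]
  [NormedAddCommGroup F] [NormedSpace ℝ F]
  {A₁ : E₁ →L[ℝ] E₁} {C₁ : E₁ →L[ℝ] F} {A₂ : E₂ →L[ℝ] E₂} {C₂ : E₂ →L[ℝ] F}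
  {b₁ : E₁} {b₂ : E₂}

theorem hasSum_output_linFlow (A : E₁ →L[ℝ] E₁) (C : E₁ →L[ℝ] F) (b : E₁) (s : ℝ) :
    HasSum (fun k : ℕ => ((k.factorial : ℝ)⁻¹ * s ^ k) • C ((A ^ k) b)) (C (linFlow A s b)) := by
  have h := NormedSpace.exp_series_hasSum_exp' (𝕂 := ℝ) (s • A)
  have h2 := (h.mapL (ContinuousLinearMap.apply ℝ E₁ b)).mapL C
  have h3 : (fun k : ℕ => ((k.factorial : ℝ)⁻¹ * s ^ k) • C ((A ^ k) b)) = fun k : ℕ =>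
      C (ContinuousLinearMap.apply ℝ E₁ b ((k.factorial : ℝ)⁻¹ • (s • A) ^ k)) := by
    funext k
    simp only [ContinuousLinearMap.apply_apply, smul_pow, map_smul, mul_smul]
  rw [h3]
  exact h2

theorem output_linFlow_eq (h : ∀ k : ℕ, C₁ ((A₁ ^ k) b₁) = C₂ ((A₂ ^ k) b₂)) (s : ℝ) :
    C₁ (linFlow A₁ s b₁) = C₂ (linFlow A₂ s b₂) := by
  have h1 := hasSum_output_linFlow A₁ C₁ b₁ s
  simp only [h] at h1
  exact h1.unique (hasSum_output_linFlow A₂ C₂ b₂ s)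

theorem eventually_mem_resolventSet (A : E₁ →L[ℝ] E₁) :
    ∀ᶠ μ : ℝ in atTop, μ ∈ resolventSet ℝ A := by
  filter_upwards [eventually_gt_atTop (‖A‖ * ‖(1 : E₁ →L[ℝ] E₁)‖)] with μ hμ
  exact spectrum.mem_resolventSet_of_norm_lt_mul (hμ.trans_le (le_abs_self μ))

omit [CompleteSpace E₁] in
theorem smul_resolvent_apply {A : E₁ →L[ℝ] E₁} {μ : ℝ} (hμ : μ ∈ resolventSet ℝ A) (b : E₁) :
    μ • resolvent A μ b = b + A (resolvent A μ b) := by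
  have h1 : (algebraMap ℝ (E₁ →L[ℝ] E₁) μ - A) * resolvent A μ = 1 :=
    Ring.mul_inverse_cancel _ hμ
  have h2 := congrArg (fun f : E₁ →L[ℝ] E₁ => f b) h1
  simp only [mul_apply_eq_comp, sub_apply, one_apply_eq_self, Algebra.algebraMap_eq_smul_one,
    smul_apply] at h2
  exact sub_eq_iff_eq_add.1 h2

theorem tendsto_output_resolvent (A : E₁ →L[ℝ] E₁) (C : E₁ →L[ℝ] F) (b : E₁) :
    Tendsto (fun μ : ℝ => C (resolvent A μ b)) atTop (𝓝 0) := by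
  have h := (spectrum.resolvent_tendsto_cobounded (𝕜 := ℝ) A).mono_left
    IsOrderBornology.atTop_le_cobounded
  have h2 := ((C ∘L ContinuousLinearMap.apply ℝ E₁ b).continuous.tendsto 0).comp h
  rw [map_zero] at h2
  exact h2

/-- If two transfer functions agree at arbitrarily large real numbers, then the Markov parameters
agree. -/
theorem markov_eq_of_frequently_transfer_eq
    (h : ∃ᶠ μ : ℝ in atTop, C₁ (resolvent A₁ μ b₁) = C₂ (resolvent A₂ μ b₂)) (k : ℕ) :
    C₁ ((A₁ ^ k) b₁) = C₂ ((A₂ ^ k) b₂) := by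
  have h' := (h.and_eventually (eventually_mem_resolventSet A₁)).and_eventually
    (eventually_mem_resolventSet A₂)
  set S : Set ℝ := {μ | (C₁ (resolvent A₁ μ b₁) = C₂ (resolvent A₂ μ b₂) ∧
    μ ∈ resolventSet ℝ A₁) ∧ μ ∈ resolventSet ℝ A₂}
  have hne : (atTop ⊓ 𝓟 S).NeBot := frequently_mem_iff_neBot.1 h'
  -- This is the resolvent identity `μ R b = b + A R b`, with `A ^ k` and `C` applied and the two
  -- systems subtracted.
  have hstep : ∀ k : ℕ, ∀ μ ∈ S, C₁ ((A₁ ^ k) b₁) - C₂ ((A₂ ^ k) b₂) =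
      μ • (C₁ ((A₁ ^ k) (resolvent A₁ μ b₁)) - C₂ ((A₂ ^ k) (resolvent A₂ μ b₂))) -
        (C₁ ((A₁ ^ (k + 1)) (resolvent A₁ μ b₁)) -
          C₂ ((A₂ ^ (k + 1)) (resolvent A₂ μ b₂))) := by
    intro k μ hμ
    rw [smul_sub, ← map_smul C₁, ← map_smul (A₁ ^ k), ← map_smul C₂, ← map_smul (A₂ ^ k),
      smul_resolvent_apply hμ.1.2, smul_resolvent_apply hμ.2, pow_succ, pow_succ]
    simp only [map_add, mul_apply_eq_comp]
    abel
  -- Agreement at order `k` removes the term with the factor `μ`. The remaining resolvent terms tend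
  -- to zero along `S`, so the constant Markov difference vanishes. Feeding this back into `hstep`
  -- gives agreement at order `k + 1`.
  have hmarkov : ∀ k : ℕ, (∀ μ ∈ S, C₁ ((A₁ ^ k) (resolvent A₁ μ b₁)) =
      C₂ ((A₂ ^ k) (resolvent A₂ μ b₂))) → C₁ ((A₁ ^ k) b₁) = C₂ ((A₂ ^ k) b₂) := by
    intro k hk
    have h1 := (tendsto_output_resolvent A₁ (C₁ ∘L A₁ ^ (k + 1)) b₁).sub
      (tendsto_output_resolvent A₂ (C₂ ∘L A₂ ^ (k + 1)) b₂)
    have h2 := (h1.neg).mono_left (inf_le_left : atTop ⊓ 𝓟 S ≤ atTop)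
    have h3 : Tendsto (fun _ : ℝ => C₁ ((A₁ ^ k) b₁) - C₂ ((A₂ ^ k) b₂)) (atTop ⊓ 𝓟 S)
        (𝓝 (-(0 - 0))) := by
      refine h2.congr' ?_
      filter_upwards [mem_inf_of_right (mem_principal_self S)] with μ hμ
      rw [hstep k μ hμ, hk μ hμ, sub_self, smul_zero, zero_sub]
      rfl
    have h4 := tendsto_nhds_unique tendsto_const_nhds h3
    simpa [sub_eq_zero] using h4
  have hall : ∀ k : ℕ, ∀ μ ∈ S, C₁ ((A₁ ^ k) (resolvent A₁ μ b₁)) =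
      C₂ ((A₂ ^ k) (resolvent A₂ μ b₂)) := by
    intro k
    induction k with
    | zero => exact fun μ hμ => hμ.1.1
    | succ k ih =>
      intro μ hμ
      have h1 := hstep k μ hμ
      rw [hmarkov k ih, ih μ hμ, sub_self, sub_self, smul_zero, zero_sub, eq_comm, neg_eq_zero,
        sub_eq_zero] at h1
      exact h1
  exact hmarkov k (hall k)

omit [CompleteSpace E₁] [CompleteSpace E₂] in
/-- Repeated differentiation of a relation between the outputs of two autonomous systems. -/
theorem output_pow_of_output {x₁ : ℝ → E₁} {x₂ : ℝ → E₂} {α β μ : ℝ} {g : F}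
    (h₁ : ∀ r ∈ Ioo α β, HasDerivAt x₁ (A₁ (x₁ r)) r)
    (h₂ : ∀ r ∈ Ioo α β, HasDerivAt x₂ (A₂ (x₂ r)) r)
    (h : ∀ r ∈ Ioo α β, C₁ (x₁ r) - C₂ (x₂ r) + Real.exp (μ * r) • g = 0) (k : ℕ) :
    ∀ r ∈ Ioo α β, C₁ ((A₁ ^ k) (x₁ r)) - C₂ ((A₂ ^ k) (x₂ r)) +
      (μ ^ k * Real.exp (μ * r)) • g = 0 := by
  induction k with
  | zero => simpa using h
  | succ k ih =>
    intro r hr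
    have d1 := (C₁ ∘L A₁ ^ k).hasFDerivAt.comp_hasDerivAt r (h₁ r hr)
    have d2 := (C₂ ∘L A₂ ^ k).hasFDerivAt.comp_hasDerivAt r (h₂ r hr)
    have d3 : HasDerivAt (fun r => (μ ^ k * Real.exp (μ * r)) • g)
        ((μ ^ (k + 1) * Real.exp (μ * r)) • g) r := by
      have := ((((hasDerivAt_id r).const_mul μ).exp).const_mul (μ ^ k)).smul_const g
      refine this.congr_deriv ?_
      rw [id, pow_succ]
      congr 1
      ring
    have d4 := (d1.sub d2).add d3
    have d5 := d4.congr_of_eventuallyEq (f₁ := fun _ => (0 : F)) (by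
      filter_upwards [Ioo_mem_nhds hr.1 hr.2] with s hs using (ih s hs).symm)
    have := d5.unique (hasDerivAt_const r (0 : F))
    rw [pow_succ, pow_succ A₂]
    exact this

omit [CompleteSpace E₁] [CompleteSpace E₂] in
-- Subtracting the particular solutions `exp(μr) (μ - A)⁻¹ b` leaves free responses. Differentiating
-- the output relation according to `p` annihilates them, so `p(μ) exp(μr)` times the transfer
-- difference is zero.
theorem transfer_eq_of_output_eq {x₁ : ℝ → E₁} {x₂ : ℝ → E₂} {α β μ : ℝ} (hαβ : α < β)
    (hμ₁ : μ ∈ resolventSet ℝ A₁) (hμ₂ : μ ∈ resolventSet ℝ A₂) {p : Polynomial ℝ}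
    (hp₁ : Polynomial.aeval A₁ p = 0) (hp₂ : Polynomial.aeval A₂ p = 0) (hp : p.eval μ ≠ 0)
    (h₁ : ∀ r ∈ Ioo α β, HasDerivAt x₁ (A₁ (x₁ r) + Real.exp (μ * r) • b₁) r)
    (h₂ : ∀ r ∈ Ioo α β, HasDerivAt x₂ (A₂ (x₂ r) + Real.exp (μ * r) • b₂) r)
    (h : ∀ r ∈ Ioo α β, C₁ (x₁ r) = C₂ (x₂ r)) :
    C₁ (resolvent A₁ μ b₁) = C₂ (resolvent A₂ μ b₂) := by
  have hexp : ∀ r : ℝ, HasDerivAt (fun r => Real.exp (μ * r)) (μ * Real.exp (μ * r)) r := by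
    intro r
    have := ((hasDerivAt_id r).const_mul μ).exp
    simpa [mul_comm] using this
  have hw₁ : ∀ r ∈ Ioo α β, HasDerivAt (fun r => x₁ r - Real.exp (μ * r) • resolvent A₁ μ b₁)
      (A₁ (x₁ r - Real.exp (μ * r) • resolvent A₁ μ b₁)) r := by
    intro r hr
    refine ((h₁ r hr).sub ((hexp r).smul_const (resolvent A₁ μ b₁))).congr_deriv ?_
    rw [mul_comm μ (Real.exp _), mul_smul, smul_resolvent_apply hμ₁, map_sub, map_smul, smul_add]
    abel
  have hw₂ : ∀ r ∈ Ioo α β, HasDerivAt (fun r => x₂ r - Real.exp (μ * r) • resolvent A₂ μ b₂)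
      (A₂ (x₂ r - Real.exp (μ * r) • resolvent A₂ μ b₂)) r := by
    intro r hr
    refine ((h₂ r hr).sub ((hexp r).smul_const (resolvent A₂ μ b₂))).congr_deriv ?_
    rw [mul_comm μ (Real.exp _), mul_smul, smul_resolvent_apply hμ₂, map_sub, map_smul, smul_add]
    abel
  have hg := output_pow_of_output (C₁ := C₁) (C₂ := C₂) (μ := μ)
    (g := C₁ (resolvent A₁ μ b₁) - C₂ (resolvent A₂ μ b₂)) hw₁ hw₂ (by
      intro r hr
      rw [map_sub, map_sub, map_smul, map_smul, h r hr, smul_sub]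
      abel)
  obtain ⟨r, hr⟩ := exists_between hαβ
  -- Linear combinations of the differentiated relations at a single time `r`.
  have hq : ∀ q : Polynomial ℝ,
      C₁ (Polynomial.aeval A₁ q (x₁ r - Real.exp (μ * r) • resolvent A₁ μ b₁)) -
        C₂ (Polynomial.aeval A₂ q (x₂ r - Real.exp (μ * r) • resolvent A₂ μ b₂)) +
        (q.eval μ * Real.exp (μ * r)) •
          (C₁ (resolvent A₁ μ b₁) - C₂ (resolvent A₂ μ b₂)) = 0 := by
    intro q
    induction q using Polynomial.induction_on' with
    | add p q hp hq =>
      rw [← add_zero (0 : F)]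
      nth_rewrite 1 [← hp]
      rw [← hq]
      simp only [map_add, add_apply, Polynomial.eval_add, add_mul, add_smul]
      abel
    | monomial n a =>
      rw [← smul_zero a, ← hg n r hr]
      simp only [Polynomial.aeval_monomial, Polynomial.eval_monomial,
        Algebra.algebraMap_eq_smul_one, smul_mul_assoc, one_mul, smul_apply, map_smul, smul_add,
        smul_sub, mul_assoc, mul_smul]
  have := hq p
  rw [hp₁, hp₂] at this
  simpa [hp, sub_eq_zero] using this

end Outputs

/-! ### The distinguishing input -/

namespace GLSw

variable {Q : Type*} {m l : ℕ} {H : GLSw Q m l} {t₀ : ℝ}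

/-- With equal Markov parameters the impulse responses agree. The switch-free executions from the
origin in the modes `a` and `b` then have the same output for every input, and no observer can name
both modes. -/
theorem LocationObservable.exists_markov_ne (hH : H.LocationObservable t₀) {a b : Q}
    (hab : a ≠ b) : ∃ v : Euc m, ∃ k : ℕ,
      eucCLM (H.C a) ((eucCLM (H.A a) ^ k) (eucCLM (H.B a) v)) ≠
        eucCLM (H.C b) ((eucCLM (H.A b) ^ k) (eucCLM (H.B b) v)) := by
  by_contra! hM
  obtain ⟨u, hu, obs, hobs⟩ := hH
  obtain ⟨T, hT, hobs⟩ := hobs 1 one_pos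
  have hsw : ¬ (TimeBasis.single t₀).IsSwitchingTime T := by
    rintro ⟨j, -, hj⟩
    exact hT.ne' hj
  have hmem : ∀ s, t₀ ≤ s → s ∈ (TimeBasis.single t₀).interval 0 := fun s hs =>
    ⟨hs, fun h => absurd h (by simp [TimeBasis.single])⟩
  have hξ : ∀ i s, t₀ ≤ s → (Execution.single H t₀ i hu 0).ξ s = ⟨i, H.sol i u t₀ 0 s⟩ :=
    fun i s hs => (Execution.single H t₀ i hu 0).ξ_eq 0 (TimeBasis.zero_lt_L _) s (hmem s hs)
  have hy : ∀ i s, t₀ ≤ s → (Execution.single H t₀ i hu 0).y s =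
      ∫ r in t₀..s, eucCLM (H.C i) (linFlow (eucCLM (H.A i)) (s - r) (eucCLM (H.B i) (u r))) := by
    intro i s hs
    rw [(Execution.single H t₀ i hu 0).y_eq 0 (TimeBasis.zero_lt_L _) s (hmem s hs)]
    have h1 := (hu.isForcing (eucCLM (H.B i))).linSol_zero_left (eucCLM (H.A i)) t₀ s
    have h2 := (hu.isForcing (eucCLM (H.B i))).intervalIntegrable_linFlow (eucCLM (H.A i)) s t₀ s
    rw [ContinuousLinearMap.intervalIntegral_comp_comm _ h2, ← h1]
    rfl
  have hyy : (Icc t₀ T).domRestrict (Execution.single H t₀ a hu 0).y =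
      (Icc t₀ T).domRestrict (Execution.single H t₀ b hu 0).y := by
    funext s
    change (Execution.single H t₀ a hu 0).y s = (Execution.single H t₀ b hu 0).y s
    rw [hy a s s.2.1, hy b s s.2.1]
    exact intervalIntegral.integral_congr fun r _ => output_linFlow_eq (hM (u r)) _
  have key : ∀ i, obs T ((Icc t₀ T).domRestrict (Execution.single H t₀ i hu 0).y)
      ((Ico t₀ T).domRestrict u) = i := by
    intro i
    rw [hobs (Execution.single H t₀ i hu 0) rfl (by rw [hξ i t₀ le_rfl]; simp) T le_rfl hsw,
      hξ i T hT.le]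
  exact hab (by rw [← key a, ← key b, hyy])

/-- The input `u` allows one to read off the discrete state from the output on every time
interval. -/
def Distinguishes (H : GLSw Q m l) (u : ℝ → Euc m) : Prop :=
  ∀ (a b : Q) (x : ℝ → Euc (H.n a)) (z : ℝ → Euc (H.n b)) (α β : ℝ), α < β →
    (∀ r ∈ Ioo α β, HasDerivAt x (eucCLM (H.A a) (x r) + eucCLM (H.B a) (u r)) r) →
    (∀ r ∈ Ioo α β, HasDerivAt z (eucCLM (H.A b) (z r) + eucCLM (H.B b) (u r)) r) →
    (∀ r ∈ Ioo α β, eucCLM (H.C a) (x r) = eucCLM (H.C b) (z r)) → a = b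

/-- A location observable system has a distinguishing input. -/
theorem LocationObservable.exists_distinguishing_input [Finite Q]
    (hH : H.LocationObservable t₀) : ∃ u : ℝ → Euc m, Continuous u ∧ H.Distinguishes u := by
  have := Fintype.ofFinite Q
  classical
  -- `N e` consists of the input directions in which the two modes have equal Markov parameters. It
  -- is proper for distinct modes, and finitely many proper subspaces do not cover a real vector
  -- space.
  let N : Q × Q → Submodule ℝ (Euc m) := fun e => ⨅ k : ℕ, LinearMap.eqLocus
    ((eucCLM (H.C e.1) ∘L (eucCLM (H.A e.1) ^ k) ∘L eucCLM (H.B e.1)).toLinearMap)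
    ((eucCLM (H.C e.2) ∘L (eucCLM (H.A e.2) ^ k) ∘L eucCLM (H.B e.2)).toLinearMap)
  have hN : ∀ e v, v ∈ N e ↔ ∀ k : ℕ,
      eucCLM (H.C e.1) ((eucCLM (H.A e.1) ^ k) (eucCLM (H.B e.1) v)) =
        eucCLM (H.C e.2) ((eucCLM (H.A e.2) ^ k) (eucCLM (H.B e.2) v)) := by
    intro e v
    rw [Submodule.mem_iInf]
    rfl
  obtain ⟨v, hv⟩ : ∃ v, ∀ e : Q × Q, e.1 ≠ e.2 → v ∉ N e := by
    have h := Subspace.biUnion_ne_univ_of_top_notMem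
      (s := (Finset.univ.filter fun e : Q × Q => e.1 ≠ e.2).image N) (by
        simp only [Finset.mem_image, Finset.mem_filter, Finset.mem_univ, true_and, not_exists,
          not_and]
        intro e he htop
        obtain ⟨v, k, hk⟩ := hH.exists_markov_ne he
        exact hk ((hN e v).1 (htop ▸ Submodule.mem_top) k))
    obtain ⟨v, hv⟩ := (ne_univ_iff_exists_notMem _).1 h
    refine ⟨v, fun e he hve => hv ?_⟩
    simp only [mem_iUnion]
    exact ⟨N e, Finset.mem_image_of_mem N (by simpa using he), hve⟩
  have hpoly : ∀ i : Q, ∃ p : Polynomial ℝ, p ≠ 0 ∧ Polynomial.aeval (eucCLM (H.A i)) p = 0 := by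
    intro i
    obtain ⟨p, hp, hp0⟩ := IsIntegral.of_finite ℝ (eucCLM (H.A i))
    exact ⟨p, hp.ne_zero, hp0⟩
  choose p hp0 hp using hpoly
  -- All conditions hold for large `μ`: it exceeds the spectra and the roots of the annihilating
  -- polynomials, and equality of transfer functions for arbitrarily large `μ` would put `v` into `N
  -- e`.
  have hev : ∀ᶠ μ : ℝ in atTop, (∀ i : Q, μ ∈ resolventSet ℝ (eucCLM (H.A i))) ∧
      (∀ i : Q, (p i).eval μ ≠ 0) ∧ ∀ e : Q × Q, e.1 ≠ e.2 →
        eucCLM (H.C e.1) (resolvent (eucCLM (H.A e.1)) μ (eucCLM (H.B e.1) v)) ≠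
          eucCLM (H.C e.2) (resolvent (eucCLM (H.A e.2)) μ (eucCLM (H.B e.2) v)) := by
    refine (eventually_all.2 fun i => eventually_mem_resolventSet _).and
      ((eventually_all.2 fun i => ?_).and (eventually_all.2 fun e => ?_))
    · have h1 := (p i).roots.toFinset.finite_toSet.bddAbove
      obtain ⟨M, hM⟩ := h1
      filter_upwards [eventually_gt_atTop M] with μ hμ h0
      refine absurd (hM ?_) (not_le.2 hμ)
      simp [hp0 i, h0]
    · by_cases he : e.1 = e.2
      · exact .of_forall fun _ h => absurd he h
      · have h1 : ¬ ∃ᶠ μ : ℝ in atTop,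
            eucCLM (H.C e.1) (resolvent (eucCLM (H.A e.1)) μ (eucCLM (H.B e.1) v)) =
              eucCLM (H.C e.2) (resolvent (eucCLM (H.A e.2)) μ (eucCLM (H.B e.2) v)) :=
          fun hf => hv e he ((hN e v).2 (markov_eq_of_frequently_transfer_eq hf))
        exact (not_frequently.1 h1).mono fun μ h _ => h
  obtain ⟨μ, hres, hroot, hne⟩ := hev.exists
  refine ⟨fun r => Real.exp (μ * r) • v, by fun_prop, ?_⟩
  intro a b x z α β hαβ hx hz hy
  by_contra hab
  simp only [map_smul] at hx hz
  refine hne (a, b) hab (transfer_eq_of_output_eq hαβ (hres a) (hres b) (p := p a * p b)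
    ?_ ?_ ?_ hx hz hy)
  · rw [map_mul, hp, zero_mul]
  · rw [map_mul, hp b, mul_zero]
  · rw [Polynomial.eval_mul]
    exact mul_ne_zero (hroot a) (hroot b)

end GLSw

/-! ### Necessity: lifting executions of the unobservable part -/

namespace GLSw

variable {Q : Type*} {m l : ℕ} {H : GLSw Q m l} {t₀ : ℝ}
  {F : ∀ i : H.Unobs, ObsCanonicalForm (H.A i.1) (H.C i.1)}

theorem exists_coordinate_bound [Finite Q]
    (F : ∀ i : H.Unobs, ObsCanonicalForm (H.A i.1) (H.C i.1)) :
    ∃ c > 0, ∀ i, (∀ z, ‖(F i).unobsIncl z‖ ≤ c * ‖z‖) ∧ ∀ x, ‖(F i).unobsProj x‖ ≤ c * ‖x‖ := by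
  obtain ⟨c₁, h₁⟩ := (finite_range fun i => ‖(F i).unobsIncl‖).bddAbove
  obtain ⟨c₂, h₂⟩ := (finite_range fun i => ‖(F i).unobsProj‖).bddAbove
  refine ⟨max 1 (max c₁ c₂), by positivity, fun i => ⟨fun z => ?_, fun x => ?_⟩⟩
  · refine (F i).unobsIncl.le_of_opNorm_le ((h₁ ⟨i, rfl⟩).trans ?_) z
    exact (le_max_left _ _).trans (le_max_right _ _)
  · refine (F i).unobsProj.le_of_opNorm_le ((h₂ ⟨i, rfl⟩).trans ?_) x
    exact (le_max_right _ _).trans (le_max_right _ _)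

namespace Execution

variable (χ : (H.unobservablePart F).Execution t₀)

/-- The curves of an execution of the unobservable part. -/
def curve (j : ℕ) : ℝ → Euc (F (χ.mode j)).d := χ.x j

theorem curve_continuousOn {j : ℕ} (hj : (j : ℕ∞) < χ.τ.L) :
    ContinuousOn (χ.curve j) (χ.τ.interval j) := (χ.flow j hj).1

theorem curve_eq {j : ℕ} (hj : (j : ℕ∞) < χ.τ.L) {s : ℝ} (hs : s ∈ χ.τ.interval j) :
    χ.curve j s = χ.curve j (χ.τ.t j) +
      ∫ r in χ.τ.t j..s, eucCLM (F (χ.mode j)).A22 (χ.curve j r) := by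
  refine ((χ.flow j hj).2 s hs).trans ?_
  congr 1
  refine intervalIntegral.integral_congr fun r _ => ?_
  change eucCLM _ _ + eucCLM 0 _ = _
  rw [eucCLM_zero, add_zero]
  rfl

theorem curve_jump {j : ℕ} (hj : ((j + 1 : ℕ) : ℕ∞) < χ.τ.L) :
    ((χ.mode j).1, (χ.mode (j + 1)).1) ∈ H.E ∧ ∃ w : Euc (F (χ.mode j)).d,
      Tendsto (χ.curve j) (𝓝[<] χ.τ.t (j + 1)) (𝓝 w) ∧
      eucCLM (H.R (χ.mode j).1 (χ.mode (j + 1)).1) ((F (χ.mode j)).unobsIncl w) =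
        (F (χ.mode (j + 1))).unobsIncl (χ.curve (j + 1) (χ.τ.t (j + 1))) := by
  obtain ⟨hE, w, hw, hG, hR⟩ := χ.jump j hj
  refine ⟨hE, w, hw, ?_⟩
  have hG' : eucCLM ((F (χ.mode (j + 1))).T * H.R (χ.mode j).1 (χ.mode (j + 1)).1 *
      (F (χ.mode j)).Tinv).toBlocks₁₂ w = 0 := hG
  rw [(F (χ.mode j)).reset_unobsIncl (F (χ.mode (j + 1))) _ hG']
  exact congrArg _ hR.symm

/-- The initial states of the pieces of the execution of `H` from the origin that switches
together with `χ`. -/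
def baseState (u : ℝ → Euc m) : ∀ j : ℕ, Euc (H.n (χ.mode j).1)
  | 0 => 0
  | j + 1 => eucCLM (H.R (χ.mode j).1 (χ.mode (j + 1)).1)
      (H.sol (χ.mode j).1 u (χ.τ.t j) (baseState u j) (χ.τ.t (j + 1)))

/-- The pieces of the execution of `H` that switches together with `χ` and differs from the
execution from the origin by `c` times the unobservable state of `χ`. -/
def liftPiece (u : ℝ → Euc m) (c : ℝ) (j : ℕ) : H.Piece :=
  ⟨(χ.mode j).1, fun s => H.sol (χ.mode j).1 u (χ.τ.t j) (χ.baseState u j) s +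
    c • (F (χ.mode j)).unobsIncl (χ.curve j s)⟩

theorem isSolution_liftPiece {u : ℝ → Euc m} (hu : IsPiecewiseContinuous u) (c : ℝ) {j : ℕ}
    (hj : (j : ℕ∞) < χ.τ.L) :
    H.IsSolution (χ.liftPiece u c j).1 u (χ.τ.interval j) (χ.τ.t j) (χ.liftPiece u c j).2 := by
  have hcont : ContinuousOn (fun s => c • (F (χ.mode j)).unobsIncl (χ.curve j s))
      (χ.τ.interval j) :=
    ((F (χ.mode j)).unobsIncl.continuous.comp_continuousOn (χ.curve_continuousOn hj)).const_smul c
  have hsol := continuous_sol (χ.mode j).1 hu (χ.τ.t j) (χ.baseState u j)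
  refine ⟨hsol.continuousOn.add hcont, fun s hs => ?_⟩
  change _ = _ + ∫ r in χ.τ.t j..s, (eucCLM (H.A (χ.mode j).1) ((χ.liftPiece u c j).2 r) +
    eucCLM (H.B (χ.mode j).1) (u r))
  have hsub : uIcc (χ.τ.t j) s ⊆ χ.τ.interval j := by
    rw [uIcc_of_le hs.1]
    exact χ.τ.Icc_subset_interval hs
  have h1 := (hu.isForcing (eucCLM (H.B (χ.mode j).1))).linSol_eq (eucCLM (H.A (χ.mode j).1))
    (χ.τ.t j) (χ.baseState u j) s
  have i1 : IntervalIntegrable (fun r => eucCLM (H.A (χ.mode j).1)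
      (H.sol (χ.mode j).1 u (χ.τ.t j) (χ.baseState u j) r) + eucCLM (H.B (χ.mode j).1) (u r))
      volume (χ.τ.t j) s :=
    (((eucCLM (H.A (χ.mode j).1)).continuous.comp hsol).intervalIntegrable _ _).add
      ((hu.isForcing (eucCLM (H.B (χ.mode j).1))).intervalIntegrable _ _)
  have i2 : IntervalIntegrable (fun r => eucCLM (F (χ.mode j)).A22 (χ.curve j r))
      volume (χ.τ.t j) s :=
    ((eucCLM (F (χ.mode j)).A22).continuous.comp_continuousOn
      ((χ.curve_continuousOn hj).mono hsub)).intervalIntegrable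
  have i3 : IntervalIntegrable (fun r => c • eucCLM (H.A (χ.mode j).1)
      ((F (χ.mode j)).unobsIncl (χ.curve j r))) volume (χ.τ.t j) s :=
    (((eucCLM (H.A (χ.mode j).1)).continuous.comp_continuousOn
      ((F (χ.mode j)).unobsIncl.continuous.comp_continuousOn
        ((χ.curve_continuousOn hj).mono hsub))).const_smul c).intervalIntegrable
  have h2 : c • (F (χ.mode j)).unobsIncl (χ.curve j s) =
      c • (F (χ.mode j)).unobsIncl (χ.curve j (χ.τ.t j)) + ∫ r in χ.τ.t j..s,
        c • eucCLM (H.A (χ.mode j).1) ((F (χ.mode j)).unobsIncl (χ.curve j r)) := by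
    rw [χ.curve_eq hj hs, map_add, smul_add, ← ContinuousLinearMap.intervalIntegral_comp_comm _ i2,
      ← intervalIntegral.integral_smul]
    -- The unobservable subspace is invariant under `A`, where it acts as `A22`.
    simp only [(F (χ.mode j)).apply_unobsIncl]
  have h3 : (fun r => eucCLM (H.A (χ.mode j).1) ((χ.liftPiece u c j).2 r) +
      eucCLM (H.B (χ.mode j).1) (u r)) = fun r => (eucCLM (H.A (χ.mode j).1)
      (H.sol (χ.mode j).1 u (χ.τ.t j) (χ.baseState u j) r) + eucCLM (H.B (χ.mode j).1) (u r)) +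
      c • eucCLM (H.A (χ.mode j).1) ((F (χ.mode j)).unobsIncl (χ.curve j r)) := by
    funext r
    simp only [liftPiece, map_add, map_smul]
    abel
  rw [h3, intervalIntegral.integral_add i1 i3]
  change H.sol _ _ _ _ s + c • (F (χ.mode j)).unobsIncl (χ.curve j s) =
    (H.sol _ _ _ _ _ + c • (F (χ.mode j)).unobsIncl (χ.curve j (χ.τ.t j))) + _
  rw [h2, sol, h1]
  abel

theorem jump_liftPiece (hH : H.IsLSw) {u : ℝ → Euc m} (hu : IsPiecewiseContinuous u) (c : ℝ)
    {j : ℕ} (hj : ((j + 1 : ℕ) : ℕ∞) < χ.τ.L) :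
    H.Jump (χ.τ.t (j + 1)) (χ.liftPiece u c j) (χ.liftPiece u c (j + 1)) := by
  obtain ⟨hE, w, hw, hR⟩ := χ.curve_jump hj
  refine ⟨hE, H.sol (χ.mode j).1 u (χ.τ.t j) (χ.baseState u j) (χ.τ.t (j + 1)) +
    c • (F (χ.mode j)).unobsIncl w, ?_, ?_, ?_⟩
  · exact (((continuous_sol _ hu _ _).tendsto _).mono_left nhdsWithin_le_nhds).add
      ((((F (χ.mode j)).unobsIncl.continuous.tendsto w).comp hw).const_smul c)
  · change _ ∈ H.G (χ.mode j).1 (χ.mode (j + 1)).1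
    rw [hH _ _ hE]
    exact mem_univ _
  · change H.sol _ _ _ _ _ + c • (F (χ.mode (j + 1))).unobsIncl _ =
      eucCLM (H.R (χ.mode j).1 (χ.mode (j + 1)).1) (_ + _)
    rw [map_add, map_smul, hR, sol_self]
    rfl

/-- The execution of `H` that switches together with `χ` and differs from the execution from the
origin by `c` times the unobservable state of `χ`. -/
def lift (hH : H.IsLSw) {u : ℝ → Euc m} (hu : IsPiecewiseContinuous u) (c : ℝ) :
    H.Execution t₀ :=
  ofPieces χ.τ u hu (χ.liftPiece u c) (fun _ hj => χ.isSolution_liftPiece hu c hj)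
    fun _ hj => χ.jump_liftPiece hH hu c hj

theorem lift_ξ (hH : H.IsLSw) {u : ℝ → Euc m} (hu : IsPiecewiseContinuous u) (c : ℝ) {j : ℕ}
    (hj : (j : ℕ∞) < χ.τ.L) {s : ℝ} (hs : s ∈ χ.τ.interval j) : (χ.lift hH hu c).ξ s =
      ⟨(χ.mode j).1, H.sol (χ.mode j).1 u (χ.τ.t j) (χ.baseState u j) s +
        c • (F (χ.mode j)).unobsIncl (χ.curve j s)⟩ :=
  (χ.lift hH hu c).ξ_eq j hj s hs

theorem lift_y (hH : H.IsLSw) {u : ℝ → Euc m} (hu : IsPiecewiseContinuous u) (c : ℝ) {j : ℕ}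
    (hj : (j : ℕ∞) < χ.τ.L) {s : ℝ} (hs : s ∈ χ.τ.interval j) : (χ.lift hH hu c).y s =
      eucCLM (H.C (χ.mode j).1) (H.sol (χ.mode j).1 u (χ.τ.t j) (χ.baseState u j) s) := by
  refine ((χ.lift hH hu c).y_eq j hj s hs).trans ?_
  change eucCLM (H.C (χ.mode j).1) (_ + c • (F (χ.mode j)).unobsIncl (χ.curve j s)) = _
  rw [map_add, map_smul, (F (χ.mode j)).output_unobsIncl, smul_zero, add_zero]

end Execution

theorem hdist_mk {i : Q} (x₁ x₂ : Euc (H.n i)) :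
    H.hdist ⟨i, x₁⟩ ⟨i, x₂⟩ = ENNReal.ofReal ‖x₁ - x₂‖ := by
  simp only [hdist, dite_true]
  rw [edist_dist, dist_eq_norm]

theorem norm_sub_le_of_hdist_le {a : H.State} {i : Q} {x₁ x₂ : Euc (H.n i)} {ε : ℝ} (hε : 0 ≤ ε)
    (h₁ : H.hdist a ⟨i, x₁⟩ ≤ ENNReal.ofReal ε) (h₂ : H.hdist a ⟨i, x₂⟩ ≤ ENNReal.ofReal ε) :
    ‖x₁ - x₂‖ ≤ 2 * ε := by
  obtain ⟨k, x⟩ := a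
  by_cases hk : k = i
  · subst hk
    rw [hdist_mk, ENNReal.ofReal_le_ofReal_iff hε, ← dist_eq_norm] at h₁ h₂
    rw [← dist_eq_norm]
    linarith [dist_triangle_left x₁ x₂ x]
  · simp [hdist, hk] at h₁

theorem fst_eq_of_hdist_le {a b : H.State} {ε : ℝ} (h : H.hdist a b ≤ ENNReal.ofReal ε) :
    a.1 = b.1 := by
  by_contra hab
  simp [hdist, hab] at h

theorem Detectable.locationObservable (h : H.Detectable t₀) : H.LocationObservable t₀ := by
  obtain ⟨u, hu, obs, hobs⟩ := h
  refine ⟨u, hu, fun t y v => (obs t y v).1, fun ρ hρ => ?_⟩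
  obtain ⟨T, hT, h⟩ := hobs 1 one_pos ρ hρ
  exact ⟨T, hT, fun χ hχ hρ t ht hsw => fst_eq_of_hdist_le (h χ hχ hρ t ht hsw)⟩

theorem Detectable.asymptoticallyStable [Finite Q] (hH : H.IsLSw) (h : H.Detectable t₀)
    (F : ∀ i : H.Unobs, ObsCanonicalForm (H.A i.1) (H.C i.1)) :
    (H.unobservablePart F).AsymptoticallyStable t₀ := by
  obtain ⟨u, hu, obs, hobs⟩ := h
  obtain ⟨c, hc, hcb⟩ := exists_coordinate_bound F
  intro ε hε ρ hρ
  -- Two lifts with the same estimate are at most `2 · ε / (2c)` apart, and passing to unobservable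
  -- coordinates costs a factor `c`. The lifts start in the ball of radius `c * ρ` because the base
  -- execution starts at the origin.
  obtain ⟨T, hT, h⟩ := hobs (ε / (2 * c)) (by positivity) (c * ρ) (by positivity)
  refine ⟨T, hT, fun χ hχ t ht => ?_⟩
  obtain ⟨j, hj, htj⟩ := χ.τ.exists_mem_interval (hT.le.trans ht)
  have hinit : ∀ a : ℝ, ‖a‖ ≤ 1 → ‖((χ.lift hH hu a).ξ t₀).2‖ ≤ c * ρ := by
    intro a ha
    have h0 := χ.τ.zero_lt_L
    have hmem := χ.τ.t_zero_mem_interval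
    rw [χ.lift_ξ hH hu a h0 hmem]
    rw [χ.ξ_eq 0 h0 t₀ hmem] at hχ
    have hb : H.sol (χ.mode 0).1 u (χ.τ.t 0) (χ.baseState u 0) t₀ = 0 := by
      rw [χ.τ.t_zero, sol_self]
      rfl
    simp only [hb, zero_add, norm_smul]
    calc ‖a‖ * _ ≤ 1 * (c * ‖χ.curve 0 t₀‖) := by
          gcongr
          exact (hcb _).1 _
      _ ≤ c * ρ := by
          rw [one_mul]
          gcongr
          exact hχ
  have hyy : ∀ s, t₀ ≤ s → (χ.lift hH hu 1).y s = (χ.lift hH hu 0).y s := by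
    intro s hs
    obtain ⟨k, hk, hsk⟩ := χ.τ.exists_mem_interval hs
    rw [χ.lift_y hH hu 1 hk hsk, χ.lift_y hH hu 0 hk hsk]
  have key : ∀ s ∈ χ.τ.interval j, t ≤ s → χ.τ.t j < s → ‖χ.curve j s‖ ≤ ε := by
    intro s hs hts hjs
    have hsw := χ.τ.not_isSwitchingTime hj hs hjs
    have d1 := h (χ.lift hH hu 1) rfl (hinit 1 (by simp)) s (ht.trans hts) hsw
    have d0 := h (χ.lift hH hu 0) rfl (hinit 0 (by simp)) s (ht.trans hts) hsw
    have hres : (Icc t₀ s).domRestrict (χ.lift hH hu 1).y =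
        (Icc t₀ s).domRestrict (χ.lift hH hu 0).y := by
      funext r
      exact hyy r r.2.1
    rw [hres, χ.lift_ξ hH hu 1 hj hs] at d1
    rw [χ.lift_ξ hH hu 0 hj hs] at d0
    have hd := norm_sub_le_of_hdist_le (by positivity) d1 d0
    rw [one_smul, zero_smul, add_zero, add_sub_cancel_left] at hd
    calc ‖χ.curve j s‖ = ‖(F (χ.mode j)).unobsProj ((F (χ.mode j)).unobsIncl (χ.curve j s))‖ := by
          rw [(F (χ.mode j)).unobsProj_unobsIncl]
      _ ≤ c * (2 * (ε / (2 * c))) := ((hcb _).2 _).trans (by gcongr)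
      _ = ε := by field_simp
  rw [χ.ξ_eq j hj t htj]
  change ‖χ.curve j t‖ ≤ ε
  -- Detectability says nothing at switching times, and `t` may be one. The bound at `t` is the
  -- limit of the bounds at later times of the same interval.
  obtain ⟨b, hb, hbj⟩ := χ.τ.exists_mem_interval_gt htj
  have hcont : Tendsto (χ.curve j) (𝓝[>] t) (𝓝 (χ.curve j t)) := by
    refine ((χ.curve_continuousOn hj) t htj).mono_left ?_
    rw [← nhdsWithin_Ioo_eq_nhdsGT hb]
    exact nhdsWithin_mono _ fun r hr => χ.τ.Icc_subset_interval hbj ⟨htj.1.trans hr.1.le, hr.2.le⟩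
  refine le_of_tendsto hcont.norm ?_
  filter_upwards [Ioo_mem_nhdsGT hb] with r hr
  exact key r (χ.τ.Icc_subset_interval hbj ⟨htj.1.trans hr.1.le, hr.2.le⟩) hr.1.le
    (htj.1.trans_lt hr.1)

end GLSw

/-! ### Reachable states of the unobservable part -/

namespace TimeBasis

variable {t₀ : ℝ}

/-- The time basis with an additional last switching time. -/
def extend (τ : TimeBasis t₀) {N : ℕ} (hN : τ.L = (N + 1 : ℕ)) {s : ℝ} (hs : τ.t N < s) :
    TimeBasis t₀ where
  L := (N + 2 : ℕ)
  one_le := by exact_mod_cast Nat.le_add_left 1 (N + 1)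
  t j := if j ≤ N then τ.t j else s
  t_zero := by simp [τ.t_zero]
  t_lt j hj := by
    have hj' : j + 1 < N + 2 := by exact_mod_cast hj
    rw [if_pos (by omega : j ≤ N)]
    split_ifs with h
    · exact τ.t_lt j (by rw [hN]; exact_mod_cast Nat.lt_succ_of_le h)
    · rwa [show j = N by omega]
  nonZeno T := (finite_Iio (N + 2)).subset fun j hj => by exact_mod_cast hj.1

variable (τ : TimeBasis t₀) {N : ℕ} (hN : τ.L = (N + 1 : ℕ)) {s : ℝ} (hs : τ.t N < s)

theorem lt_extend_L {j : ℕ} : (j : ℕ∞) < (τ.extend hN hs).L ↔ j < N + 2 := Nat.cast_lt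

theorem extend_t_of_le {j : ℕ} (hj : j ≤ N) : (τ.extend hN hs).t j = τ.t j := if_pos hj

theorem extend_t_succ : (τ.extend hN hs).t (N + 1) = s := if_neg (by omega)

include hN in
theorem lt_L_of_le {j : ℕ} (hj : j ≤ N) : (j : ℕ∞) < τ.L := by
  rw [hN]
  exact_mod_cast Nat.lt_succ_of_le hj

include hN in
theorem mem_last_interval {r : ℝ} (hr : τ.t N ≤ r) : r ∈ τ.interval N :=
  ⟨hr, fun h => absurd h (by rw [hN]; exact lt_irrefl _)⟩

theorem extend_interval_subset {j : ℕ} (hj : j ≤ N) :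
    (τ.extend hN hs).interval j ⊆ τ.interval j := by
  rintro r ⟨h1, h2⟩
  rw [τ.extend_t_of_le hN hs hj] at h1
  refine ⟨h1, fun h => ?_⟩
  have hj' : j + 1 ≤ N := by
    rw [hN] at h
    exact Nat.le_of_lt_succ (by exact_mod_cast h)
  rw [← τ.extend_t_of_le hN hs hj']
  exact h2 ((τ.lt_extend_L hN hs).2 (by omega))

end TimeBasis

namespace GLSw

variable {Q : Type*} {m l : ℕ} {H : GLSw Q m l} {t₀ : ℝ}

theorem IsSolution.mono {i : Q} {u : ℝ → Euc m} {I I' : Set ℝ} {a : ℝ} {x : ℝ → Euc (H.n i)}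
    (h : H.IsSolution i u I a x) (hI : I' ⊆ I) : H.IsSolution i u I' a x :=
  ⟨h.1.mono hI, fun s hs => h.2 s (hI hs)⟩

/-- An execution whose last switch is before time `s` can be made to jump at time `s`. -/
theorem Execution.exists_extend (χ : H.Execution t₀) {N : ℕ} (hN : χ.τ.L = (N + 1 : ℕ)) {s : ℝ}
    (hs : χ.τ.t N < s) {h : Q} (hE : (χ.mode N, h) ∈ H.E)
    (hG : χ.x N s ∈ H.G (χ.mode N) h) :
    ∃ χ' : H.Execution t₀, χ'.ξ t₀ = χ.ξ t₀ ∧ χ'.τ.L = (N + 2 : ℕ) ∧ χ'.τ.t (N + 1) = s ∧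
      χ'.ξ s = ⟨h, eucCLM (H.R (χ.mode N) h) (χ.x N s)⟩ := by
  let p : ℕ → H.Piece := fun j => if j ≤ N then ⟨χ.mode j, χ.x j⟩ else
    ⟨h, H.sol h χ.u s (eucCLM (H.R (χ.mode N) h) (χ.x N s))⟩
  have hp : ∀ j ≤ N, p j = ⟨χ.mode j, χ.x j⟩ := fun j hj => if_pos hj
  have hp' : p (N + 1) = ⟨h, H.sol h χ.u s (eucCLM (H.R (χ.mode N) h) (χ.x N s))⟩ :=
    if_neg (by omega)
  let τ' := χ.τ.extend hN hs
  have hflow : ∀ j : ℕ, (j : ℕ∞) < τ'.L →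
      H.IsSolution (p j).1 χ.u (τ'.interval j) (τ'.t j) (p j).2 := by
    intro j hj
    have hj' : j < N + 2 := (χ.τ.lt_extend_L hN hs).1 hj
    rcases Nat.lt_succ_iff_lt_or_eq.1 hj' with h1 | rfl
    · have h2 := Nat.le_of_lt_succ h1
      rw [hp j h2, χ.τ.extend_t_of_le hN hs h2]
      exact (χ.flow j (χ.τ.lt_L_of_le hN h2)).mono (χ.τ.extend_interval_subset hN hs h2)
    · rw [hp', χ.τ.extend_t_succ hN hs]
      exact isSolution_sol h χ.u_pc s _ _
  have hjump : ∀ j : ℕ, ((j + 1 : ℕ) : ℕ∞) < τ'.L →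
      H.Jump (τ'.t (j + 1)) (p j) (p (j + 1)) := by
    intro j hj
    have hj' : j + 1 < N + 2 := (χ.τ.lt_extend_L hN hs).1 hj
    rcases Nat.lt_succ_iff_lt_or_eq.1 hj' with h1 | h1
    · have h2 := Nat.le_of_lt_succ h1
      rw [hp j (by omega), hp (j + 1) h2, χ.τ.extend_t_of_le hN hs h2]
      exact χ.jump j (χ.τ.lt_L_of_le hN h2)
    · obtain rfl : j = N := by omega
      rw [hp j le_rfl, hp', χ.τ.extend_t_succ hN hs]
      refine ⟨hE, χ.x j s, ?_, hG, sol_self _ _ _ _⟩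
      have hc := (χ.flow j (χ.τ.lt_L_of_le hN le_rfl)).1 s (χ.τ.mem_last_interval hN hs.le)
      refine (hc.mono_left ?_)
      rw [← nhdsWithin_Ioo_eq_nhdsLT hs]
      exact nhdsWithin_mono _ fun r hr => χ.τ.mem_last_interval hN hr.1.le
  refine ⟨Execution.ofPieces τ' χ.u χ.u_pc p hflow hjump, ?_, rfl, χ.τ.extend_t_succ hN hs, ?_⟩
  · rw [χ.ξ_eq 0 χ.τ.zero_lt_L t₀ χ.τ.t_zero_mem_interval]
    change (⟨(activePiece τ' p t₀).1, (activePiece τ' p t₀).2 t₀⟩ : H.State) = _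
    rw [activePiece_eq τ' p τ'.zero_lt_L τ'.t_zero_mem_interval, hp 0 (Nat.zero_le N)]
  · change (⟨(activePiece τ' p s).1, (activePiece τ' p s).2 s⟩ : H.State) = _
    have hlt : ((N + 1 : ℕ) : ℕ∞) < τ'.L :=
      (χ.τ.lt_extend_L hN hs).2 (Nat.lt_succ_self (N + 1))
    have hmem : s ∈ τ'.interval (N + 1) := by
      have := τ'.left_mem_interval (j := N + 1)
      rwa [χ.τ.extend_t_succ hN hs] at this
    rw [activePiece_eq τ' p hlt hmem, hp']
    simp

variable (F : ∀ i : H.Unobs, ObsCanonicalForm (H.A i.1) (H.C i.1))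

/-- The state `z` of the discrete state `i` of the unobservable part can be reached at time `s`,
after finitely many switches, from an initial state of norm at most `ρ`. -/
def Reach (t₀ ρ s : ℝ) (i : H.Unobs) (z : Euc (F i).d) : Prop :=
  ∃ χ : (H.unobservablePart F).Execution t₀, ‖(χ.ξ t₀).2‖ ≤ ρ ∧
    ∃ N : ℕ, χ.τ.L = (N + 1 : ℕ) ∧ χ.τ.t N ≤ s ∧ χ.ξ s = ⟨i, z⟩

variable {F} {ρ s s' : ℝ} {i : H.Unobs} {z : Euc (F i).d}

theorem reach_initial (hz : ‖z‖ ≤ ρ) : Reach F t₀ ρ t₀ i z := by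
  have hu : IsPiecewiseContinuous (fun _ : ℝ => (0 : Euc 0)) :=
    continuous_const.isPiecewiseContinuous
  let χ := Execution.single (H.unobservablePart F) t₀ i hu z
  have hξ : χ.ξ t₀ = ⟨i, z⟩ := by
    rw [χ.ξ_eq 0 χ.τ.zero_lt_L t₀ χ.τ.t_zero_mem_interval]
    exact congrArg (Sigma.mk i) (sol_self (H := H.unobservablePart F) i _ t₀ z)
  exact ⟨χ, by rw [hξ]; exact hz, 0, by simp [χ, Execution.single, TimeBasis.single,
    Execution.ofPieces], le_rfl, hξ⟩

theorem Execution.curve_eq_linFlow (χ : (H.unobservablePart F).Execution t₀) {j : ℕ}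
    (hj : (j : ℕ∞) < χ.τ.L) (hs : s ∈ χ.τ.interval j) (hs' : s' ∈ χ.τ.interval j)
    (hss : s ≤ s') :
    χ.curve j s' = linFlow (eucCLM (F (χ.mode j)).A22) (s' - s) (χ.curve j s) := by
  have hsub := χ.τ.Icc_subset_interval hs'
  refine eq_linFlow _ hss ((χ.curve_continuousOn hj).mono
    ((Icc_subset_Icc_left hs.1).trans hsub)) fun r hr => ?_
  have := hasDerivAt_of_integral_eq (A := eucCLM (F (χ.mode j)).A22) (g := fun _ => 0)
    continuous_const ((χ.curve_continuousOn hj).mono (Ico_subset_Icc_self.trans hsub))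
    (fun q hq => by simpa using χ.curve_eq hj (hsub (Ico_subset_Icc_self hq)))
    ⟨hs.1.trans_lt hr.1, hr.2⟩
  simpa using this

/-- The last interval of the witness is unbounded, so the same execution serves at the later time.
-/
theorem Reach.flow (h : Reach F t₀ ρ s i z) (hss : s ≤ s') :
    Reach F t₀ ρ s' i (linFlow (eucCLM (F i).A22) (s' - s) z) := by
  obtain ⟨χ, hρ, N, hN, hs, hξ⟩ := h
  have hlt := χ.τ.lt_L_of_le hN le_rfl
  have h1 := χ.τ.mem_last_interval hN hs
  have h2 := χ.τ.mem_last_interval hN (hs.trans hss)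
  refine ⟨χ, hρ, N, hN, hs.trans hss, ?_⟩
  rw [χ.ξ_eq N hlt s h1] at hξ
  rw [χ.ξ_eq N hlt s' h2]
  have h3 := χ.curve_eq_linFlow hlt h1 h2 hss
  obtain ⟨rfl, h4⟩ := Sigma.mk.inj_iff.1 hξ
  rw [← eq_of_heq h4]
  exact congrArg (Sigma.mk _) h3

/-- The witness is cut at `s'` and continued in mode `k`. The strict inequality keeps the switching
times strictly increasing. -/
theorem Reach.jump (h : Reach F t₀ ρ s i z) (hss : s < s') {k : H.Unobs}
    (hE : (i.1, k.1) ∈ H.E)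
    (hG : eucCLM ((F k).T * H.R i.1 k.1 * (F i).Tinv).toBlocks₁₂
      (linFlow (eucCLM (F i).A22) (s' - s) z) = 0) :
    Reach F t₀ ρ s' k (eucCLM ((F k).T * H.R i.1 k.1 * (F i).Tinv).toBlocks₂₂
      (linFlow (eucCLM (F i).A22) (s' - s) z)) := by
  obtain ⟨χ, hρ, N, hN, hs, hξ⟩ := h
  have hlt := χ.τ.lt_L_of_le hN le_rfl
  have h1 := χ.τ.mem_last_interval hN hs
  have h2 := χ.τ.mem_last_interval hN (hs.trans hss.le)
  rw [χ.ξ_eq N hlt s h1] at hξ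
  have h3 := χ.curve_eq_linFlow hlt h1 h2 hss.le
  obtain ⟨rfl, h4⟩ := Sigma.mk.inj_iff.1 hξ
  rw [← eq_of_heq h4] at hG ⊢
  change eucCLM _ (linFlow _ _ (χ.curve N s)) = 0 at hG
  rw [← h3] at hG
  obtain ⟨χ', h0, hL, ht, hξ'⟩ := χ.exists_extend hN (hs.trans_lt hss) (h := k) hE hG
  refine ⟨χ', by rwa [h0], N + 1, hL, ht.le, hξ'.trans ?_⟩
  refine congrArg (Sigma.mk k) ?_
  change _ = eucCLM _ (linFlow _ _ (χ.curve N s))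
  rw [← h3]
  rfl

theorem Reach.norm_le {ε T : ℝ}
    (hT : ∀ χ : (H.unobservablePart F).Execution t₀, ‖(χ.ξ t₀).2‖ ≤ ρ →
      ∀ t ≥ T, ‖(χ.ξ t).2‖ ≤ ε) (h : Reach F t₀ ρ s i z) (hs : T ≤ s) : ‖z‖ ≤ ε := by
  obtain ⟨χ, hρ, N, -, -, hξ⟩ := h
  have := hT χ hρ s hs
  rwa [hξ] at this

end GLSw

/-! ### Sufficiency: comparing two executions with the same output -/

namespace GLSw

variable {Q : Type*} {m l : ℕ} {H : GLSw Q m l} {t₀ : ℝ}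

/-- The state `d` of the discrete state `i` is either zero or a reachable state of the unobservable
part. -/
def Tracked (F : ∀ i : H.Unobs, ObsCanonicalForm (H.A i.1) (H.C i.1)) (t₀ ρ s : ℝ) (i : Q)
    (d : Euc (H.n i)) : Prop :=
  Invisible (H.A i) (H.C i) d ∧ (d = 0 ∨ ∃ hi : ¬ IsObservablePair (H.A i) (H.C i),
    Reach F t₀ ρ s ⟨i, hi⟩ ((F ⟨i, hi⟩).unobsProj d))

namespace Execution

variable {χ₁ χ₂ : H.Execution t₀} {a b : ℝ} {i : Q} {x z : ℝ → Euc (H.n i)}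

theorem Arc.hasDerivAt_sub (hu : χ₁.u = χ₂.u) (h₁ : χ₁.Arc i x a b) (h₂ : χ₂.Arc i z a b) :
    ∀ r ∈ Ioo a b, HasDerivAt (fun r => x r - z r) (eucCLM (H.A i) (x r - z r)) r := by
  intro r hr
  refine ((h₁.hasDerivAt r hr).sub (h₂.hasDerivAt r hr)).congr_deriv ?_
  rw [hu, map_sub]
  abel

/-- The difference is a free response with zero output on the open interval. Repeated
differentiation gives invisibility there, and continuity extends it to the endpoints. -/
theorem Arc.invisible_sub (hu : χ₁.u = χ₂.u) (h₁ : χ₁.Arc i x a b) (h₂ : χ₂.Arc i z a b)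
    (hy : ∀ r ∈ Ioo a b, χ₁.y r = χ₂.y r) :
    ∀ r ∈ Icc a b, Invisible (H.A i) (H.C i) (x r - z r) := by
  have hd := h₁.hasDerivAt_sub hu h₂
  -- The second system is at rest and the exponential term is absent.
  have key := output_pow_of_output (A₁ := eucCLM (H.A i)) (C₁ := eucCLM (H.C i))
    (A₂ := eucCLM (H.A i)) (C₂ := eucCLM (H.C i)) (x₂ := fun _ => 0) (μ := 0) (g := 0) hd
    (fun r _ => by simpa using hasDerivAt_const r (0 : Euc (H.n i))) (fun r hr => by
      have h := hy r hr
      rw [h₁.y_eq r (Ioo_subset_Ico_self hr), h₂.y_eq r (Ioo_subset_Ico_self hr)] at h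
      simp [h])
  intro r hr k
  have hEq : EqOn (fun r => eucCLM (H.C i) ((eucCLM (H.A i) ^ k) (x r - z r))) (fun _ => 0)
      (Ioo a b) := fun r hr => by
    have h := key k r hr
    rw [smul_zero, add_zero, map_zero, map_zero, sub_zero] at h
    exact h
  refine hEq.of_subset_closure ?_ continuousOn_const Ioo_subset_Icc_self
    (closure_Ioo h₁.lt.ne).ge hr
  exact (eucCLM (H.C i)).continuous.comp_continuousOn
    ((eucCLM (H.A i) ^ k).continuous.comp_continuousOn (h₁.continuousOn.sub h₂.continuousOn))

theorem Arc.sub_eq_linFlow (hu : χ₁.u = χ₂.u) (h₁ : χ₁.Arc i x a b) (h₂ : χ₂.Arc i z a b)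
    {r : ℝ} (hr : r ∈ Icc a b) :
    x r - z r = linFlow (eucCLM (H.A i)) (r - a) (x a - z a) :=
  eq_linFlow (x := fun r => x r - z r) _ hr.1
    ((h₁.continuousOn.sub h₂.continuousOn).mono (Icc_subset_Icc_right hr.2))
    fun q hq => h₁.hasDerivAt_sub hu h₂ q ⟨hq.1, hq.2.trans_le hr.2⟩

variable {F : ∀ i : H.Unobs, ObsCanonicalForm (H.A i.1) (H.C i.1)} {ρ : ℝ}

/-- Invisibility removes the observable coordinates, so the coupling through `A₂₁` disappears and
the unobservable coordinates evolve autonomously. -/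
theorem Arc.unobsProj_sub_eq_linFlow (hu : χ₁.u = χ₂.u) (h₁ : χ₁.Arc i x a b)
    (h₂ : χ₂.Arc i z a b) (hy : ∀ r ∈ Ioo a b, χ₁.y r = χ₂.y r) {r : ℝ} (hr : r ∈ Icc a b)
    (G : ObsCanonicalForm (H.A i) (H.C i)) :
    G.unobsProj (x r - z r) = linFlow (eucCLM G.A22) (r - a) (G.unobsProj (x a - z a)) := by
  refine eq_linFlow (x := fun r => G.unobsProj (x r - z r)) _ hr.1
    (G.unobsProj.continuous.comp_continuousOn
      ((h₁.continuousOn.sub h₂.continuousOn).mono (Icc_subset_Icc_right hr.2))) fun q hq => ?_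
  have hq' : q ∈ Ioo a b := ⟨hq.1, hq.2.trans_le hr.2⟩
  rw [← G.unobsProj_apply (h₁.invisible_sub hu h₂ hy q (Ioo_subset_Icc_self hq'))]
  exact G.unobsProj.hasFDerivAt.comp_hasDerivAt q (h₁.hasDerivAt_sub hu h₂ q hq')

theorem Arc.tracked (hu : χ₁.u = χ₂.u) (h₁ : χ₁.Arc i x a b) (h₂ : χ₂.Arc i z a b)
    (hy : ∀ r ∈ Ioo a b, χ₁.y r = χ₂.y r) (h : Tracked F t₀ ρ a i (x a - z a)) {r : ℝ}
    (hr : r ∈ Icc a b) : Tracked F t₀ ρ r i (x r - z r) := by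
  refine ⟨h₁.invisible_sub hu h₂ hy r hr, ?_⟩
  rcases h.2 with h0 | ⟨hi, hR⟩
  · left
    rw [h₁.sub_eq_linFlow hu h₂ hr, h0, map_zero]
  · right
    refine ⟨hi, ?_⟩
    rw [h₁.unobsProj_sub_eq_linFlow hu h₂ hy hr]
    exact hR.flow hr.1

/-- Invisibility after the reset is what puts the unobservable coordinates before it into the guard.
In an observable mode the invisible difference is zero, and zero persists from then on. -/
theorem Arc.tracked_jump (hu : χ₁.u = χ₂.u) (h₁ : χ₁.Arc i x a b) (h₂ : χ₂.Arc i z a b)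
    (hy : ∀ r ∈ Ioo a b, χ₁.y r = χ₂.y r) (h : Tracked F t₀ ρ a i (x a - z a)) {k : Q}
    (hE : (i, k) ∈ H.E) (hk : Invisible (H.A k) (H.C k) (eucCLM (H.R i k) (x b - z b))) :
    Tracked F t₀ ρ b k (eucCLM (H.R i k) (x b - z b)) := by
  have hb : b ∈ Icc a b := right_mem_Icc.2 h₁.lt.le
  refine ⟨hk, ?_⟩
  rcases h.2 with h0 | ⟨hi, hR⟩
  · left
    rw [h₁.sub_eq_linFlow hu h₂ hb, h0, map_zero, map_zero]
  · by_cases hkO : IsObservablePair (H.A k) (H.C k)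
    · exact .inl (hkO.eq_zero hk.mem_obsKer)
    · refine .inr ⟨hkO, ?_⟩
      have hflow := h₁.unobsProj_sub_eq_linFlow hu h₂ hy hb (F ⟨i, hi⟩)
      have hincl := (F ⟨i, hi⟩).unobsIncl_unobsProj (h₁.invisible_sub hu h₂ hy b hb)
      have := hR.jump h₁.lt (k := ⟨k, hkO⟩) hE (by
        rw [← hflow, ObsCanonicalForm.toBlocks₁₂_reset, hincl]
        exact (F ⟨k, hkO⟩).obsProj_eq_zero hk)
      rwa [← hflow, ObsCanonicalForm.toBlocks₂₂_reset, hincl] at this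

end Execution

/-- The vector `(R - I) x = (R x - z) - (x - z)` lies in `ker O_i` as well as in the image of `R -
I`. -/
theorem SelfLoopCondition.reset_eq (hS : H.SelfLoopCondition) {i : Q} (hE : (i, i) ∈ H.E)
    {x z : Euc (H.n i)} (h : Invisible (H.A i) (H.C i) (x - z))
    (h' : Invisible (H.A i) (H.C i) (eucCLM (H.R i i) x - z)) : eucCLM (H.R i i) x = x := by
  have h1 : eucCLM (H.R i i - 1) x ∈ obsKer (H.A i) (H.C i) := by
    have := Submodule.sub_mem _ h'.mem_obsKer h.mem_obsKer
    rwa [sub_sub_sub_cancel_right, ← eucCLM_one x, ← eucCLM_mul, Matrix.mul_one,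
      ← eucCLM_sub] at this
  have h2 : eucCLM (H.R i i - 1) x ∈
      LinearMap.range (Matrix.toEuclideanLin (H.R i i - 1)) ⊓ obsKer (H.A i) (H.C i) :=
    ⟨⟨x, rfl⟩, h1⟩
  rw [hS i hE, Submodule.mem_bot, eucCLM_sub, eucCLM_one, sub_eq_zero] at h2
  exact h2

/-- Two executions with the same distinguishing input and the same output on `[t₀, t]`. -/
structure Indistinguishable (χ₁ χ₂ : H.Execution t₀) (t : ℝ) : Prop where
  continuous : Continuous χ₁.u
  distinguishes : H.Distinguishes χ₁.u
  u_eq : χ₁.u = χ₂.u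
  y_eq : ∀ s ∈ Icc t₀ t, χ₁.y s = χ₂.y s

namespace Indistinguishable

variable {χ₁ χ₂ : H.Execution t₀} {t s : ℝ} (hI : Indistinguishable χ₁ χ₂ t)

include hI

theorem mode_eq {i j : Q} {x : ℝ → Euc (H.n i)} {z : ℝ → Euc (H.n j)} {a b : ℝ} (ha : t₀ ≤ a)
    (hb : b ≤ t) (h₁ : χ₁.Arc i x a b) (h₂ : χ₂.Arc j z a b) : i = j := by
  refine hI.distinguishes i j x z a b h₁.lt h₁.hasDerivAt ?_ fun r hr => ?_
  · rw [hI.u_eq]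
    exact h₂.hasDerivAt
  · rw [← h₁.y_eq r (Ioo_subset_Ico_self hr), ← h₂.y_eq r (Ioo_subset_Ico_self hr)]
    exact hI.y_eq r ⟨ha.trans hr.1.le, hr.2.le.trans hb⟩

theorem y_eq_Ioo {a b : ℝ} (ha : t₀ ≤ a) (hb : b ≤ t) : ∀ r ∈ Ioo a b, χ₁.y r = χ₂.y r :=
  fun r hr => hI.y_eq r ⟨ha.trans hr.1.le, hr.2.le.trans hb⟩

theorem exists_arcs_right (hs : t₀ ≤ s) (hst : s < t) :
    ∃ i x z b, b ≤ t ∧ χ₁.Arc i x s b ∧ χ₂.Arc i z s b := by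
  obtain ⟨i, x, b₁, h₁⟩ := χ₁.exists_arc_right hI.continuous hs
  obtain ⟨j, z, b₂, h₂⟩ := χ₂.exists_arc_right (hI.u_eq ▸ hI.continuous) hs
  have hlt : s < min t (min b₁ b₂) := lt_min hst (lt_min h₁.lt h₂.lt)
  have h₁' := h₁.mono le_rfl ((min_le_right t _).trans (min_le_left _ _)) hlt
  have h₂' := h₂.mono le_rfl ((min_le_right t _).trans (min_le_right _ _)) hlt
  obtain rfl := hI.mode_eq hs (min_le_left _ _) h₁' h₂'
  exact ⟨i, x, z, _, min_le_left _ _, h₁', h₂'⟩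

theorem exists_arcs_left (hs : t₀ < s) (hst : s ≤ t) :
    ∃ i x z a, t₀ ≤ a ∧ χ₁.Arc i x a s ∧ χ₂.Arc i z a s ∧
      (χ₁.ξ s = ⟨i, x s⟩ ∨ χ₁.τ.IsSwitchingTime s ∧
        ∃ h, (i, h) ∈ H.E ∧ χ₁.ξ s = ⟨h, eucCLM (H.R i h) (x s)⟩) ∧
      (χ₂.ξ s = ⟨i, z s⟩ ∨ χ₂.τ.IsSwitchingTime s ∧
        ∃ h, (i, h) ∈ H.E ∧ χ₂.ξ s = ⟨h, eucCLM (H.R i h) (z s)⟩) := by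
  obtain ⟨i, x, a₁, ha, h₁, hj₁⟩ := χ₁.exists_arc_left hI.continuous hs
  obtain ⟨j, z, a₂, -, h₂, hj₂⟩ := χ₂.exists_arc_left (hI.u_eq ▸ hI.continuous) hs
  have hlt : max a₁ a₂ < s := max_lt h₁.lt h₂.lt
  have h₁' := h₁.mono (le_max_left a₁ a₂) le_rfl hlt
  have h₂' := h₂.mono (le_max_right a₁ a₂) le_rfl hlt
  obtain rfl := hI.mode_eq (ha.trans (le_max_left _ _)) hst h₁' h₂'
  exact ⟨i, x, z, _, ha.trans (le_max_left _ _), h₁', h₂', hj₁, hj₂⟩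

omit hI in
/-- At time `s` the two executions are in the same discrete state, and the difference of their
continuous states is tracked. -/
def _root_.GLSw.Synchronized (F : ∀ i : H.Unobs, ObsCanonicalForm (H.A i.1) (H.C i.1)) (ρ : ℝ)
    (χ₁ χ₂ : H.Execution t₀) (s : ℝ) : Prop :=
  ∃ i x₁ x₂, χ₁.ξ s = ⟨i, x₁⟩ ∧ χ₂.ξ s = ⟨i, x₂⟩ ∧ Tracked F t₀ ρ s i (x₁ - x₂)

variable {F : ∀ i : H.Unobs, ObsCanonicalForm (H.A i.1) (H.C i.1)} {ρ : ℝ}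

omit hI in
theorem _root_.GLSw.Synchronized.tracked {i : Q} {x₁ x₂ : Euc (H.n i)}
    (h : Synchronized F ρ χ₁ χ₂ s) (h₁ : χ₁.ξ s = ⟨i, x₁⟩) (h₂ : χ₂.ξ s = ⟨i, x₂⟩) :
    Tracked F t₀ ρ s i (x₁ - x₂) := by
  obtain ⟨j, y₁, y₂, k₁, k₂, hT⟩ := h
  rw [k₁] at h₁
  rw [k₂] at h₂
  obtain ⟨rfl, e₁⟩ := Sigma.mk.inj_iff.1 h₁
  rw [← eq_of_heq e₁, ← eq_of_heq (Sigma.mk.inj_iff.1 h₂).2]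
  exact hT

/-- The output just after `s` identifies the mode at `s`, even at a switching time. Hence `s < t`
has to be strict. -/
theorem exists_ξ_eq (hs : t₀ ≤ s) (hst : s < t) : ∃ i x₁ x₂, χ₁.ξ s = ⟨i, x₁⟩ ∧
    χ₂.ξ s = ⟨i, x₂⟩ ∧ Invisible (H.A i) (H.C i) (x₁ - x₂) := by
  obtain ⟨i, x, z, b, hb, h₁, h₂⟩ := hI.exists_arcs_right hs hst
  exact ⟨i, x s, z s, h₁.ξ_eq s (left_mem_Ico.2 h₁.lt), h₂.ξ_eq s (left_mem_Ico.2 h₁.lt),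
    h₁.invisible_sub hI.u_eq h₂ (hI.y_eq_Ioo hs hb) s (left_mem_Icc.2 h₁.lt.le)⟩

theorem synchronized_right (hs : t₀ ≤ s) (hst : s < t) (h : Synchronized F ρ χ₁ χ₂ s) :
    ∃ b > s, ∀ r ∈ Ico s b, Synchronized F ρ χ₁ χ₂ r := by
  obtain ⟨i, x, z, b, hb, h₁, h₂⟩ := hI.exists_arcs_right hs hst
  have hs' : s ∈ Ico s b := left_mem_Ico.2 h₁.lt
  have hT := h.tracked (h₁.ξ_eq s hs') (h₂.ξ_eq s hs')
  exact ⟨b, h₁.lt, fun r hr => ⟨i, x r, z r, h₁.ξ_eq r hr, h₂.ξ_eq r hr,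
    h₁.tracked hI.u_eq h₂ (hI.y_eq_Ioo hs hb) hT (Ico_subset_Icc_self hr)⟩⟩

theorem synchronized_initial (hst : t₀ < t) {c : ℝ} (hc : 0 ≤ c)
    (hF : ∀ i x, ‖(F i).unobsProj x‖ ≤ c * ‖x‖)
    (h₁ : ‖(χ₁.ξ t₀).2‖ ≤ ρ) (h₂ : ‖(χ₂.ξ t₀).2‖ ≤ ρ) :
    Synchronized F (c * (ρ + ρ)) χ₁ χ₂ t₀ := by
  obtain ⟨i, x₁, x₂, k₁, k₂, hinv⟩ := hI.exists_ξ_eq le_rfl hst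
  rw [k₁] at h₁
  rw [k₂] at h₂
  refine ⟨i, x₁, x₂, k₁, k₂, hinv, ?_⟩
  by_cases hi : IsObservablePair (H.A i) (H.C i)
  · exact .inl (hi.eq_zero hinv.mem_obsKer)
  · refine .inr ⟨hi, reach_initial ((hF _ _).trans ?_)⟩
    gcongr
    exact (norm_sub_le _ _).trans (add_le_add h₁ h₂)

theorem synchronized_left (hS : H.SelfLoopCondition) (hs : t₀ < s) (hst : s < t)
    (h : ∀ r ∈ Ico t₀ s, Synchronized F ρ χ₁ χ₂ r) : Synchronized F ρ χ₁ χ₂ s := by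
  obtain ⟨i, x, z, a, ha, h₁, h₂, hj₁, hj₂⟩ := hI.exists_arcs_left hs hst.le
  obtain ⟨k, x₁, x₂, k₁, k₂, hinv⟩ := hI.exists_ξ_eq hs.le hst
  have hlt := h₁.lt
  have hT := (h a ⟨ha, hlt⟩).tracked (h₁.ξ_eq a (left_mem_Ico.2 hlt))
    (h₂.ξ_eq a (left_mem_Ico.2 hlt))
  have hy := hI.y_eq_Ioo ha hst.le
  have hb : s ∈ Icc a s := right_mem_Icc.2 hlt.le
  have hTs := h₁.tracked hI.u_eq h₂ hy hT hb
  refine ⟨k, x₁, x₂, k₁, k₂, ?_⟩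
  -- The cases are: no jump, a jump of `χ₂` only, of `χ₁` only, and of both. Before and after `s`
  -- the modes agree, so a lone jump is a self-loop and leaves the state unchanged; a joint jump
  -- resets the difference.
  rcases hj₁ with c₁ | ⟨-, e₁, hE₁, c₁⟩ <;> rcases hj₂ with c₂ | ⟨-, e₂, hE₂, c₂⟩ <;>
    rw [k₁] at c₁ <;> rw [k₂] at c₂ <;> obtain ⟨rfl, d₁⟩ := Sigma.mk.inj_iff.1 c₁ <;>
    obtain ⟨e, d₂⟩ := Sigma.mk.inj_iff.1 c₂ <;> obtain rfl := eq_of_heq d₁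
  · obtain rfl := eq_of_heq d₂
    exact hTs
  · subst e
    obtain rfl := eq_of_heq d₂
    have h3 : Invisible (H.A k) (H.C k) (z s - x s) := fun j => by
      rw [← neg_sub, map_neg, map_neg, hTs.1 j, neg_zero]
    have h4 : Invisible (H.A k) (H.C k) (eucCLM (H.R k k) (z s) - x s) := fun j => by
      rw [← neg_sub, map_neg, map_neg, hinv j, neg_zero]
    rw [hS.reset_eq hE₂ h3 h4]
    exact hTs
  · subst e
    obtain rfl := eq_of_heq d₂
    rw [hS.reset_eq hE₁ hTs.1 hinv]
    exact hTs
  · subst e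
    obtain rfl := eq_of_heq d₂
    rw [← map_sub] at hinv ⊢
    exact h₁.tracked_jump hI.u_eq h₂ hy hT hE₁ hinv

/-- Continuous induction: at the infimum of the bad times synchronization holds by passage from the
left (or initially), and it then persists a little to the right, a contradiction. -/
theorem synchronized (hS : H.SelfLoopCondition) (h0 : Synchronized F ρ χ₁ χ₂ t₀) (hs : t₀ ≤ s)
    (hst : s < t) : Synchronized F ρ χ₁ χ₂ s := by
  by_contra hbad
  let B : Set ℝ := {r | t₀ ≤ r ∧ ¬ Synchronized F ρ χ₁ χ₂ r}
  have hBne : B.Nonempty := ⟨s, hs, hbad⟩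
  have hBdd : BddBelow B := ⟨t₀, fun r hr => hr.1⟩
  have hle : t₀ ≤ sInf B := le_csInf hBne fun r hr => hr.1
  have hlt : sInf B < t := (csInf_le hBdd ⟨hs, hbad⟩).trans_lt hst
  have hbelow : ∀ r ∈ Ico t₀ (sInf B), Synchronized F ρ χ₁ χ₂ r := fun r hr => by
    by_contra hr'
    exact absurd (csInf_le hBdd ⟨hr.1, hr'⟩) (not_le.2 hr.2)
  have hinf : Synchronized F ρ χ₁ χ₂ (sInf B) := by
    rcases hle.eq_or_lt with h | h
    · rwa [← h]
    · exact hI.synchronized_left hS h hlt hbelow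
  obtain ⟨b, hb, hgood⟩ := hI.synchronized_right hle hlt hinf
  obtain ⟨r, hr, hrb⟩ := exists_lt_of_csInf_lt hBne hb
  exact hr.2 (hgood r ⟨csInf_le hBdd hr, hrb⟩)

/-- No output after `t` is available to identify a mode entered at `t`. As neither execution
switches at `t`, both states continue from the left. -/
theorem synchronized_final (hS : H.SelfLoopCondition) (h0 : Synchronized F ρ χ₁ χ₂ t₀)
    (ht : t₀ < t) (h₁ : ¬ χ₁.τ.IsSwitchingTime t) (h₂ : ¬ χ₂.τ.IsSwitchingTime t) :
    Synchronized F ρ χ₁ χ₂ t := by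
  obtain ⟨i, x, z, a, ha, k₁, k₂, hj₁, hj₂⟩ := hI.exists_arcs_left ht le_rfl
  have hlt := k₁.lt
  have hT := (hI.synchronized hS h0 ha hlt).tracked (k₁.ξ_eq a (left_mem_Ico.2 hlt))
    (k₂.ξ_eq a (left_mem_Ico.2 hlt))
  exact ⟨i, x t, z t, hj₁.resolve_right fun h => h₁ h.1, hj₂.resolve_right fun h => h₂ h.1,
    k₁.tracked hI.u_eq k₂ (hI.y_eq_Ioo ha le_rfl) hT (right_mem_Icc.2 hlt.le)⟩

end Indistinguishable

/-! ### The estimator and its convergence -/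

/-- An estimator that follows an execution consistent with the data whose initial state is nearly
as small as possible. -/
theorem exists_estimator (hne : Nonempty H.State) (t₀ : ℝ) (u : ℝ → Euc m) :
    ∃ obs : (t : ℝ) → (Icc t₀ t → Euc l) → H.State, ∀ (χ : H.Execution t₀) (t : ℝ), χ.u = u →
      ¬ χ.τ.IsSwitchingTime t → ∃ χ' : H.Execution t₀, χ'.u = u ∧ ¬ χ'.τ.IsSwitchingTime t ∧
        (Icc t₀ t).domRestrict χ'.y = (Icc t₀ t).domRestrict χ.y ∧
        ‖(χ'.ξ t₀).2‖ ≤ ‖(χ.ξ t₀).2‖ + 1 ∧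
        obs t ((Icc t₀ t).domRestrict χ.y) = χ'.ξ t := by
  have key : ∀ (t : ℝ) (y : Icc t₀ t → Euc l), ∃ a : H.State, ∀ χ : H.Execution t₀, χ.u = u →
      ¬ χ.τ.IsSwitchingTime t → (Icc t₀ t).domRestrict χ.y = y → ∃ χ' : H.Execution t₀,
        χ'.u = u ∧ ¬ χ'.τ.IsSwitchingTime t ∧ (Icc t₀ t).domRestrict χ'.y = y ∧
        ‖(χ'.ξ t₀).2‖ ≤ ‖(χ.ξ t₀).2‖ + 1 ∧ a = χ'.ξ t := by
    intro t y
    let K : Set (H.Execution t₀) := {χ | χ.u = u ∧ ¬ χ.τ.IsSwitchingTime t ∧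
      (Icc t₀ t).domRestrict χ.y = y}
    rcases K.eq_empty_or_nonempty with hK | hK
    -- No execution fits the data, so any value will do.
    · refine ⟨hne.some, fun χ h1 h2 h3 => ?_⟩
      have : χ ∈ K := ⟨h1, h2, h3⟩
      simp [hK] at this
    · have hN : ((fun χ : H.Execution t₀ => ‖(χ.ξ t₀).2‖) '' K).Nonempty := hK.image _
      have hB : BddBelow ((fun χ : H.Execution t₀ => ‖(χ.ξ t₀).2‖) '' K) := by
        refine ⟨0, ?_⟩
        rintro _ ⟨χ, -, rfl⟩
        exact norm_nonneg _
      -- The infimum of the initial norms need not be attained, whence the slack of `1`.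
      obtain ⟨_, ⟨χ', hχ', rfl⟩, hlt⟩ := exists_lt_of_csInf_lt hN (lt_add_one _)
      refine ⟨χ'.ξ t, fun χ h1 h2 h3 => ⟨χ', hχ'.1, hχ'.2.1, hχ'.2.2, ?_, rfl⟩⟩
      have := csInf_le hB ⟨χ, ⟨h1, h2, h3⟩, rfl⟩
      exact hlt.le.trans (by gcongr)
  choose obs hobs using key
  exact ⟨obs, fun χ t h1 h2 => hobs t _ χ h1 h2 rfl⟩

theorem LocationObservable.detectable [Finite Q] (hL : H.LocationObservable t₀)
    (hS : H.SelfLoopCondition) (F : ∀ i : H.Unobs, ObsCanonicalForm (H.A i.1) (H.C i.1))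
    (hA : (H.unobservablePart F).AsymptoticallyStable t₀) : H.Detectable t₀ := by
  obtain ⟨u, hu, hdis⟩ := hL.exists_distinguishing_input
  have hne : Nonempty H.State := by
    obtain ⟨-, -, obs, -⟩ := hL
    exact ⟨⟨obs t₀ 0 0, 0⟩⟩
  obtain ⟨c, hc, hcb⟩ := exists_coordinate_bound F
  obtain ⟨obs, hobs⟩ := exists_estimator hne t₀ u
  refine ⟨u, hu.isPiecewiseContinuous, fun t y _ => obs t y, fun ε hε ρ hρ => ?_⟩
  -- Both initial states have norm at most `ρ + 1`, so their difference has unobservable coordinates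
  -- of norm at most `c * ((ρ + 1) + (ρ + 1))`. Returning from coordinates to states costs another
  -- factor `c`, whence `ε / c`.
  obtain ⟨T, hT, hst⟩ := hA (ε / c) (by positivity) (c * ((ρ + 1) + (ρ + 1))) (by positivity)
  refine ⟨T, hT, fun χ hχ hχρ t ht hsw => ?_⟩
  obtain ⟨χ', hχ', hsw', hy, hn, ho⟩ := hobs χ t hχ hsw
  have hI : Indistinguishable χ' χ t :=
    ⟨by rw [hχ']; exact hu, by rw [hχ']; exact hdis, by rw [hχ, hχ'],
      fun s hs => congrFun hy ⟨s, hs⟩⟩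
  have htt : t₀ < t := hT.trans_le ht
  have h0 := hI.synchronized_initial (F := F) (ρ := ρ + 1) htt hc.le (fun i => (hcb i).2)
    (hn.trans (by gcongr)) (hχρ.trans (by linarith))
  obtain ⟨i, x₁, x₂, k₁, k₂, hinv, hx⟩ := hI.synchronized_final hS h0 htt hsw' hsw
  have hx' : ‖x₁ - x₂‖ ≤ ε := by
    rcases hx with hx | ⟨hi, hR⟩
    · rw [hx, norm_zero]
      exact hε.le
    · have h1 := hR.norm_le hst ht
      calc ‖x₁ - x₂‖ = ‖(F ⟨i, hi⟩).unobsIncl ((F ⟨i, hi⟩).unobsProj (x₁ - x₂))‖ := by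
            rw [(F ⟨i, hi⟩).unobsIncl_unobsProj hinv]
        _ ≤ c * (ε / c) := ((hcb _).1 _).trans (by gcongr)
        _ = ε := by field_simp
  change H.hdist (obs t _) (χ.ξ t) ≤ _
  rw [ho, k₁, k₂, hdist_mk]
  exact ENNReal.ofReal_le_ofReal hx'

end GLSw

end

theorem mainTheorem3 {Q : Type*} [Finite Q] {m l : ℕ} (H : GLSw Q m l) (hH : H.IsLSw)
    (t₀ : ℝ) (F : ∀ i : H.Unobs, ObsCanonicalForm (H.A i.1) (H.C i.1)) :
    (H.LocationObservable t₀ ∧ H.SelfLoopCondition ∧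
        (H.unobservablePart F).AsymptoticallyStable t₀ →
      H.Detectable t₀) ∧
    (H.Detectable t₀ →
      H.LocationObservable t₀ ∧ (H.unobservablePart F).AsymptoticallyStable t₀) :=
  ⟨fun ⟨hL, hS, hA⟩ => hL.detectable hS F hA,
    fun h => ⟨h.locationObservable, h.asymptoticallyStable hH F⟩⟩
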